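/- Let $(\mathcal M,\omega)$ be a symplectic manifold of dimension $2d$ and let $\pi:\mathcal M\to\mathcal B$ be a fibration in Lagrangian tori, i.e. a smooth locally trivial fibration with fibre $\mathbb T^d=\mathbb R^d/\mathbb Z^d$ over a $d$-dimensional manifold $\mathcal B$, on whose fibres $\mathcal M_b=\pi^{-1}(b)$ the form $\omega$ vanishes (manifolds are smooth, Hausdorff and second countable). For $H\in C^\infty(\mathcal M)$ let $X_H$ be the Hamiltonian vector field, $\omega(X_H,\cdot)=dH$. For $b\in\mathcal B$ let $E^*_b\subset T_b^*\mathcal B$ be the lattice of the covectors $df_b$, $f\in C^\infty(\mathcal B)$, such that the flow of $X_{f\circ\pi}$ is $1$-periodic on $\mathcal M_b$, and let $E_b=\{k\in T_b\mathcal B\mid \alpha(k)\in\mathbb Z\ \text{for all }\alpha\in E_b^*\}$ be the dual lattice; $E=\bigcup_b E_b$ is the resonance bundle. A vector field $X$ on an open set $\mathcal O\subset\mathcal B$ is parallel (for Duistermaat's flat connection) if locally it is a linear combination, with constant real coefficients, of smooth sections of $E$. For $F\in C^\infty(\mathcal B)$ and a vector field $X$ on $\mathcal O$, put $\Sigma_X=\{b\in\mathcal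 O\mid dF_b(X_b)=0\}$. The function $F$ is Rüssmann non-degenerate if for every open $\mathcal O\subset\mathcal B$ and every nowhere vanishing parallel vector field $X$ on $\mathcal O$, there is no nonempty open subset of $\mathcal O$ on which $dF(X)$ vanishes identically. The dynamics of $H=F\circ\pi$ on $\mathcal M_b$ is ergodic if the flow of $X_H$ on $\mathcal M_b$ is ergodic for the Haar probability measure of $\mathcal M_b$, i.e. the probability measure on $\mathcal M_b$ invariant under the flows of all $X_{f\circ\pi}$, $f\in C^\infty(\mathcal B)$. Suppose that $F\in C^\infty(\mathcal B)$ is Rüssmann non-degenerate. Then: 1. the set of $b\in\mathcal B$ such that the dynamics of $F\circ\pi$ on $\mathcal M_b$ is ergodic is dense in $\mathcal B$; 2. for every open $\mathcal O\subset\mathcal B$ and every nowhere vanishing smooth section $k$ of $E$ over $\mathcal O$, the resonant set $\Sigma_k$ is closed in $\mathcal O$ and has empty interior; 3. the union of all the resonant sets $\Sigma_k$ of 2. (over all $\mathcal O$ and $k$) is the union of countably many of them, and it has empty interior in $\mathcal B$. -/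

import Mathlib

open scoped Manifold ContDiff Topology
open Set MeasureTheory

namespace TorusFibration

/-- The model space of `d`-dimensional manifolds. -/
abbrev Coord (d : ℕ) : Type := EuclideanSpace ℝ (Fin d)

/-- The differential `df_x` of a real function on a manifold, as a covector at `x`. -/
noncomputable def diff {n : ℕ} {N : Type*} [TopologicalSpace N] [ChartedSpace (Coord n) N]
    (f : N → ℝ) (x : N) : TangentSpace 𝓘(ℝ, Coord n) x →L[ℝ] ℝ :=
  mfderiv 𝓘(ℝ, Coord n) 𝓘(ℝ, ℝ) f x

/-- The expression in a chart `e` of a field `σ` of alternating 2-forms: the pullback of `σ`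
by `e.symm`. -/
noncomputable def chartForm {n : ℕ} {M : Type*} [TopologicalSpace M] [ChartedSpace (Coord n) M]
    (σ : ∀ m : M, TangentSpace 𝓘(ℝ, Coord n) m [⋀^Fin 2]→L[ℝ] ℝ)
    (e : OpenPartialHomeomorph M (Coord n)) (x : Coord n) : Coord n [⋀^Fin 2]→L[ℝ] ℝ :=
  (σ (e.symm x)).compContinuousLinearMap
    (mfderiv 𝓘(ℝ, Coord n) 𝓘(ℝ, Coord n) e.symm x)

/-- A symplectic form: a smooth, closed, nondegenerate 2-form. Smoothness and closedness are
expressed in all charts of the smooth structure. -/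
structure SymplecticForm (n : ℕ) (M : Type*) [TopologicalSpace M] [ChartedSpace (Coord n) M] where
  /-- the 2-form -/
  form : ∀ m : M, TangentSpace 𝓘(ℝ, Coord n) m [⋀^Fin 2]→L[ℝ] ℝ
  smooth : ∀ e ∈ IsManifold.maximalAtlas 𝓘(ℝ, Coord n) ∞ M,
    ContDiffOn ℝ ∞ (chartForm form e) e.target
  closed : ∀ e ∈ IsManifold.maximalAtlas 𝓘(ℝ, Coord n) ∞ M,
    ∀ x ∈ e.target, extDeriv (chartForm form e) x = 0
  nondegenerate : ∀ (m : M) (u : TangentSpace 𝓘(ℝ, Coord n) m),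
    (∀ v : TangentSpace 𝓘(ℝ, Coord n) m, form m ![u, v] = 0) → u = 0

section Hamiltonian

variable {n : ℕ} {M : Type*} [TopologicalSpace M] [ChartedSpace (Coord n) M]

instance finiteDimensional_tangentSpace (m : M) : FiniteDimensional ℝ (TangentSpace 𝓘(ℝ, Coord n) m) :=
  inferInstanceAs (FiniteDimensional ℝ (Coord n))

/-- The linear map `u ↦ σ_m(u, ·)`. -/
noncomputable def SymplecticForm.flat (σ : SymplecticForm n M) (m : M) :
    TangentSpace 𝓘(ℝ, Coord n) m →ₗ[ℝ] Module.Dual ℝ (TangentSpace 𝓘(ℝ, Coord n) m) :=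
  LinearMap.mk₂ ℝ (fun u v => σ.form m ![u, v])
    (fun u u' v => (σ.form m).toMultilinearMap.cons_add ![v] u u')
    (fun c u v => (σ.form m).toMultilinearMap.cons_smul ![v] c u)
    (fun u v v' => by
      have h : ∀ w, ![u, w] = Function.update ![u, 0] 1 w := fun w => by
        ext i; fin_cases i <;> rfl
      rw [h (v + v'), h v, h v']
      exact (σ.form m).toMultilinearMap.map_update_add ![u, 0] 1 v v')
    (fun c u v => by
      have h : ∀ w, ![u, w] = Function.update ![u, 0] 1 w := fun w => by
        ext i; fin_cases i <;> rfl
      rw [h (c • v), h v]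
      exact (σ.form m).toMultilinearMap.map_update_smul ![u, 0] 1 c v)

theorem SymplecticForm.flat_apply (σ : SymplecticForm n M) (m : M)
    (u v : TangentSpace 𝓘(ℝ, Coord n) m) : σ.flat m u v = σ.form m ![u, v] := rfl

theorem SymplecticForm.flat_injective (σ : SymplecticForm n M) (m : M) :
    Function.Injective (σ.flat m) := by
  rw [injective_iff_map_eq_zero]
  intro u hu
  exact σ.nondegenerate m u fun v => by rw [← σ.flat_apply, hu]; rfl

/-- The isomorphism `u ↦ σ_m(u, ·)` from tangent vectors to covectors. -/
noncomputable def SymplecticForm.flatEquiv (σ : SymplecticForm n M) (m : M) :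
    TangentSpace 𝓘(ℝ, Coord n) m ≃ₗ[ℝ] Module.Dual ℝ (TangentSpace 𝓘(ℝ, Coord n) m) :=
  (σ.flat m).linearEquivOfInjective (σ.flat_injective m) Subspace.dual_finrank_eq.symm

/-- The Hamiltonian vector field `X_H`, defined by `σ(X_H, ·) = dH`. -/
noncomputable def SymplecticForm.hamVF (σ : SymplecticForm n M) (H : M → ℝ) (m : M) :
    TangentSpace 𝓘(ℝ, Coord n) m :=
  (σ.flatEquiv m).symm (diff H m).toLinearMap

theorem SymplecticForm.form_hamVF (σ : SymplecticForm n M) (H : M → ℝ) (m : M)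
    (v : TangentSpace 𝓘(ℝ, Coord n) m) : σ.form m ![σ.hamVF H m, v] = diff H m v := by
  have h : σ.flat m (σ.hamVF H m) = (diff H m).toLinearMap :=
    (σ.flatEquiv m).apply_symm_apply _
  rw [← σ.flat_apply, h]; rfl

/-- `φ` is the (complete) flow of the vector field `X`. -/
def IsFlow (X : ∀ m : M, TangentSpace 𝓘(ℝ, Coord n) m) (φ : ℝ → M → M) : Prop :=
  ∀ m, φ 0 m = m ∧ IsMIntegralCurve (I := 𝓘(ℝ, Coord n)) (fun t => φ t m) X

end Hamiltonian

section Fibration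

variable {d : ℕ} {M : Type*} [TopologicalSpace M] [ChartedSpace (Coord (2 * d)) M]
  {B : Type*} [TopologicalSpace B] [ChartedSpace (Coord d) B]
  [IsManifold 𝓘(ℝ, Coord d) ∞ B]

/-- `π : M → B` is a smooth locally trivial fibration with fibre the torus `ℝ^d / ℤ^d`.
A trivialization over an open set `O` is given as a local diffeomorphism
`ψ : O × ℝ^d → π⁻¹(O)` over `O`, onto, whose point preimages are exactly the `ℤ^d`-orbits; this is
the same as a diffeomorphism `O × (ℝ^d / ℤ^d) ≃ π⁻¹(O)` over `O`. -/
def IsTorusFibration (π : M → B) : Prop :=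
  ContMDiff 𝓘(ℝ, Coord (2 * d)) 𝓘(ℝ, Coord d) ∞ π ∧
  ∀ b : B, ∃ O : Set B, IsOpen O ∧ b ∈ O ∧ ∃ ψ : B × Coord d → M,
    IsLocalDiffeomorphOn (𝓘(ℝ, Coord d).prod 𝓘(ℝ, Coord d)) 𝓘(ℝ, Coord (2 * d)) ∞ ψ (O ×ˢ univ) ∧
    (∀ x ∈ O, ∀ θ, π (ψ (x, θ)) = x) ∧
    (∀ m, π m ∈ O → ∃ θ, ψ (π m, θ) = m) ∧
    (∀ x ∈ O, ∀ θ θ' : Coord d,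
      ψ (x, θ) = ψ (x, θ') ↔ ∃ z : Fin d → ℤ, ∀ i, θ' i = θ i + z i)

/-- A fibration in Lagrangian tori: a torus fibration such that `σ` vanishes on the tangent spaces
`ker dπ_m` of the fibres, which have half the dimension of `M`. -/
def IsLagrangianTorusFibration (σ : SymplecticForm (2 * d) M) (π : M → B) : Prop :=
  IsTorusFibration (d := d) π ∧
  ∀ (m : M) (u v : TangentSpace 𝓘(ℝ, Coord (2 * d)) m),
    mfderiv 𝓘(ℝ, Coord (2 * d)) 𝓘(ℝ, Coord d) π m u = 0 →
    mfderiv 𝓘(ℝ, Coord (2 * d)) 𝓘(ℝ, Coord d) π m v = 0 → σ.form m ![u, v] = 0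

/-- The fibre over `b` of the action bundle `E*`. The symplectic form identifies the covector
`df_b` with the parallel vector field `X_{f ∘ π}` on the torus `π⁻¹(b)`; the covector belongs to
the lattice `E*_b` when that field is 1-periodic on the torus. -/
def actionLattice (σ : SymplecticForm (2 * d) M) (π : M → B) (b : B) :
    Set (TangentSpace 𝓘(ℝ, Coord d) b →L[ℝ] ℝ) :=
  {α | ∃ f : B → ℝ, ContMDiff 𝓘(ℝ, Coord d) 𝓘(ℝ, ℝ) ∞ f ∧ diff f b = α ∧
    ∀ γ : ℝ → M, IsMIntegralCurve (I := 𝓘(ℝ, Coord (2 * d))) γ (σ.hamVF (f ∘ π)) →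
      π (γ 0) = b → Function.Periodic γ 1}

/-- The fibre over `b` of the resonance bundle `E`: the lattice of tangent vectors dual to the
lattice `E*_b`. -/
def resonanceLattice (σ : SymplecticForm (2 * d) M) (π : M → B) (b : B) :
    Set (TangentSpace 𝓘(ℝ, Coord d) b) :=
  {k | ∀ α ∈ actionLattice σ π b, ∃ z : ℤ, α k = z}

/-- `k` is a smooth section over `O` of the resonance bundle. -/
def IsResonanceSection (σ : SymplecticForm (2 * d) M) (π : M → B)
    (k : ∀ b : B, TangentSpace 𝓘(ℝ, Coord d) b) (O : Set B) : Prop :=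
  ContMDiffOn 𝓘(ℝ, Coord d) 𝓘(ℝ, Coord d).tangent ∞
    (fun b => (⟨b, k b⟩ : TangentBundle 𝓘(ℝ, Coord d) B)) O ∧
  ∀ b ∈ O, k b ∈ resonanceLattice σ π b

/-- `X` is parallel over `O` for Duistermaat's connection, the flat connection on `B` for which the
sections of the lattice bundle `E` are parallel: locally, `X` is a combination with constant real
coefficients of smooth sections of `E`. -/
def IsParallel (σ : SymplecticForm (2 * d) M) (π : M → B)
    (X : ∀ b : B, TangentSpace 𝓘(ℝ, Coord d) b) (O : Set B) : Prop :=
  ∀ b ∈ O, ∃ U : Set B, IsOpen U ∧ b ∈ U ∧ U ⊆ O ∧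
    ∃ (r : ℕ) (k : Fin r → ∀ b : B, TangentSpace 𝓘(ℝ, Coord d) b) (c : Fin r → ℝ),
      (∀ i, IsResonanceSection σ π (k i) U) ∧ ∀ x ∈ U, X x = ∑ i, c i • k i x

/-- The resonant set over `O` of a vector field: the points of `O` where `Ω_X = dF(X)` vanishes. -/
def resonantSet (F : B → ℝ) (X : ∀ b : B, TangentSpace 𝓘(ℝ, Coord d) b) (O : Set B) : Set B :=
  {b ∈ O | diff F b (X b) = 0}

/-- Rüssmann's nondegeneracy condition: the frequency map does not annihilate, on a nonempty open
set, a nowhere vanishing (local) parallel vector field. The frequency at `b` is the parallel 1-form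
equal to `dF` at `b`, and its (constant) value on a parallel field `X` is `dF_b(X_b)`. -/
def IsRussmann (σ : SymplecticForm (2 * d) M) (π : M → B) (F : B → ℝ) : Prop :=
  ∀ (O : Set B) (X : ∀ b : B, TangentSpace 𝓘(ℝ, Coord d) b), IsOpen O →
    IsParallel σ π X O → (∀ b ∈ O, X b ≠ 0) →
    ¬ ∃ U : Set B, IsOpen U ∧ U.Nonempty ∧ U ⊆ O ∧ ∀ b ∈ U, diff F b (X b) = 0

/-- `μ` is the Haar probability measure of the affine torus `π⁻¹(b)`, seen as a measure on `M`:
the probability measure carried by `π⁻¹(b)` and invariant under the translations of the torus,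
i.e. under the flows of the parallel vector fields `X_{f ∘ π}`. -/
def IsTorusHaar [MeasurableSpace M] (σ : SymplecticForm (2 * d) M) (π : M → B) (b : B)
    (μ : Measure M) : Prop :=
  IsProbabilityMeasure μ ∧ μ (π ⁻¹' {b})ᶜ = 0 ∧
  ∀ f : B → ℝ, ContMDiff 𝓘(ℝ, Coord d) 𝓘(ℝ, ℝ) ∞ f →
    ∀ φ : ℝ → M → M, IsFlow (σ.hamVF (f ∘ π)) φ →
      ∀ (t : ℝ) (A : Set M), MeasurableSet A → μ (φ t ⁻¹' A) = μ A

/-- The dynamics of the Hamiltonian `H` on the torus `π⁻¹(b)` is ergodic for the Haar measure of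
the torus: a measurable set that is invariant (up to null sets) under the flow of `X_H` is null or
conull. -/
def IsErgodicTorus [MeasurableSpace M] (σ : SymplecticForm (2 * d) M) (π : M → B) (H : M → ℝ)
    (b : B) : Prop :=
  ∃ μ : Measure M, IsTorusHaar σ π b μ ∧ ∃ φ : ℝ → M → M, IsFlow (σ.hamVF H) φ ∧
    ∀ A : Set M, MeasurableSet A → (∀ t : ℝ, φ t ⁻¹' A =ᵐ[μ] A) → μ A = 0 ∨ μ Aᶜ = 0

/-- The pairs `(O, k)` of an open set `O ⊆ B` and a nowhere vanishing smooth section `k` over `O`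
of the resonance bundle. -/
def resonanceSections (σ : SymplecticForm (2 * d) M) (π : M → B) :
    Set (Set B × (∀ b : B, TangentSpace 𝓘(ℝ, Coord d) b)) :=
  {p | IsOpen p.1 ∧ IsResonanceSection σ π p.2 p.1 ∧ ∀ b ∈ p.1, p.2 b ≠ 0}

end Fibration

end TorusFibration

open TorusFibration

open TorusFibration

/-! Near a point of the base, lift a trivialization to `Ψ : D × ℝ^d → M`. Pairing vertical with
horizontal vectors under `Ψ*σ` gives, on each `{x} × ℝ^d`, a 1-form `mixedForm` whose values are
covectors of the base. It is `ℤ^d`-periodic. Because the fibres are Lagrangian, closedness of `σ`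
makes it closed along the fibre, nondegeneracy makes it injective at each point, and `X_{f ∘ π}` is
the vertical vector that it sends to `df`.

The primitive `S` of such a form (`exists_developing`) stays at bounded distance from a linear map,
hence is a proper local homeomorphism between vector spaces, hence a bijection. It turns `ℤ^d` into
translations by the periods of the form, and `X_{f ∘ π}` into the constant field `df`. So every
fibre is a torus on which all these flows are linear (`IsLocalModel.exists_torusChart`), the lattice
`E*_b` is the integer span of the periods, and `E_b` is its dual. The periods are integrals
depending smoothly on the base point, so `E` has smooth local frames (`exists_localFrame`).

Over the domain of a frame, a nonzero vector of `E` is a nonzero integer combination of the frame.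
Countably many frames and integer vectors therefore account for all resonances. Each resonant set is
relatively closed, and has empty interior by Rüssmann's condition, a section of `E` being itself
parallel; by Baire the union has dense complement. Off this union the frequency has no integer
relation, and a Fourier argument (`ergodic_linear_flow`) gives ergodicity.

Action coordinates are not needed: closedness of the period forms on the base plays no role, since
parallel fields are defined through sections of `E`. -/

namespace TorusFibration

/-! ### Smoothness of integrals depending on a parameter -/

section ParametricIntegral

variable {E : Type*} [NormedAddCommGroup E] [NormedSpace ℝ E] [FiniteDimensional ℝ E]
  {D : Set E}

/-- The partial derivative is continuous, hence bounded on the compact product of a closed ball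
around `x` and `[0, 1]`; the bound serves as the dominating constant. -/
theorem hasFDerivAt_intervalIntegral_of_contDiffOn
    {G : Type*} [NormedAddCommGroup G] [NormedSpace ℝ G] (hD : IsOpen D) {g : E × ℝ → G}
    (hg : ContDiffOn ℝ 1 g (D ×ˢ univ)) {x : E} (hx : x ∈ D) :
    HasFDerivAt (fun x => ∫ t in (0 : ℝ)..1, g (x, t))
      (∫ t in (0 : ℝ)..1, (fderiv ℝ g (x, t)).comp (ContinuousLinearMap.inl ℝ E ℝ)) x := by
  have hDo : IsOpen (D ×ˢ (univ : Set ℝ)) := hD.prod isOpen_univ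
  have hF' : ContinuousOn (fun p : E × ℝ =>
      (fderiv ℝ g p).comp (ContinuousLinearMap.inl ℝ E ℝ)) (D ×ˢ univ) :=
    ((hg.continuousOn_fderiv_of_isOpen hDo le_rfl).clm_comp continuousOn_const)
  have hslice : ∀ y ∈ D, Continuous fun t : ℝ => (y, t) := fun y _ => by fun_prop
  have hcg : ∀ y ∈ D, Continuous fun t : ℝ => g (y, t) := fun y hy =>
    hg.continuousOn.comp_continuous (hslice y hy) fun t => ⟨hy, mem_univ _⟩
  have hcF' : ∀ y ∈ D, Continuous fun t : ℝ =>
      (fderiv ℝ g (y, t)).comp (ContinuousLinearMap.inl ℝ E ℝ) := fun y hy =>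
    hF'.comp_continuous (hslice y hy) fun t => ⟨hy, mem_univ _⟩
  obtain ⟨r, hr, hrD⟩ := Metric.nhds_basis_closedBall.mem_iff.1 (hD.mem_nhds hx)
  have hK : IsCompact (Metric.closedBall x r ×ˢ Icc (0 : ℝ) 1) :=
    (isCompact_closedBall x r).prod isCompact_Icc
  obtain ⟨C, hC⟩ := hK.exists_bound_of_continuousOn
    (hF'.mono (prod_mono hrD (subset_univ _)))
  refine intervalIntegral.hasFDerivAt_integral_of_dominated_of_fderiv_le (bound := fun _ => C)
    (F := fun y t => g (y, t))
    (F' := fun y t => (fderiv ℝ g (y, t)).comp (ContinuousLinearMap.inl ℝ E ℝ))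
    (Metric.closedBall_mem_nhds x hr) ?_ ((hcg x hx).intervalIntegrable _ _)
    (hcF' x hx).aestronglyMeasurable ?_ (by simp) ?_
  · filter_upwards [hD.mem_nhds hx] with y hy using (hcg y hy).aestronglyMeasurable
  · refine Filter.Eventually.of_forall fun t ht y hy => hC (y, t) ⟨hy, ?_⟩
    rw [uIoc_of_le zero_le_one] at ht
    exact ⟨ht.1.le, ht.2⟩
  · refine Filter.Eventually.of_forall fun t _ y hy => ?_
    have h1 : HasFDerivAt g (fderiv ℝ g (y, t)) (y, t) :=
      ((hg.contDiffAt (hDo.mem_nhds ⟨hrD hy, mem_univ _⟩)).differentiableAt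
        one_ne_zero).hasFDerivAt
    exact h1.comp y (hasFDerivAt_prodMk_left y t)

/-- Induction on the order: in finite dimension it suffices to treat the derivative along each fixed
`v`, which is again an integral of the same kind, with integrand `fderiv ℝ g · (v, 0)`. -/
theorem contDiffOn_intervalIntegral
    {G : Type*} [NormedAddCommGroup G] [NormedSpace ℝ G] [FiniteDimensional ℝ G]
    (hD : IsOpen D) {g : E × ℝ → G}
    (hg : ContDiffOn ℝ ∞ g (D ×ˢ univ)) :
    ContDiffOn ℝ ∞ (fun x => ∫ t in (0 : ℝ)..1, g (x, t)) D := by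
  have hDo : IsOpen (D ×ˢ (univ : Set ℝ)) := hD.prod isOpen_univ
  rw [contDiffOn_infty]
  intro n
  induction n generalizing G with
  | zero =>
    exact contDiffOn_zero.2 fun x hx => (hasFDerivAt_intervalIntegral_of_contDiffOn hD
      (hg.of_le (by simp)) hx).continuousAt.continuousWithinAt
  | succ n ih =>
    have hd := fun x (hx : x ∈ D) => hasFDerivAt_intervalIntegral_of_contDiffOn hD
      (hg.of_le (by simp)) hx
    push_cast
    rw [contDiffOn_succ_iff_fderiv_of_isOpen hD]
    refine ⟨fun x hx => (hd x hx).differentiableAt.differentiableWithinAt, by simp, ?_⟩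
    refine contDiffOn_clm_apply.2 fun v => ?_
    have h2 : ContDiffOn ℝ ∞ (fun p : E × ℝ => fderiv ℝ g p (v, 0)) (D ×ˢ univ) :=
      (hg.fderiv_of_isOpen hDo (by simp)).clm_apply contDiffOn_const
    refine (ih h2).congr fun x hx => ?_
    have hc : Continuous fun t : ℝ =>
        (fderiv ℝ g (x, t)).comp (ContinuousLinearMap.inl ℝ E ℝ) :=
      ((hg.continuousOn_fderiv_of_isOpen hDo (by simp)).comp_continuous
        (by fun_prop) fun t => ⟨hx, mem_univ _⟩).clm_comp continuous_const
    rw [(hd x hx).fderiv, ContinuousLinearMap.intervalIntegral_apply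
      (hc.intervalIntegrable _ _)]
    simp

end ParametricIntegral

/-! ### Proper local homeomorphisms of vector spaces -/

section ProperLocalHomeomorph

/-- Fibres are compact and discrete, hence finite, and the map is closed, so it is a covering. The
target is simply connected, so the identity lifts to a section `T`; both `T ∘ S` and `id` lift `S`
and agree at `0`, so they coincide. -/
theorem bijective_of_isLocalHomeomorph_of_tendsto_cocompact
    {E G : Type*} [NormedAddCommGroup E] [NormedSpace ℝ E]
    [NormedAddCommGroup G] [NormedSpace ℝ G] [LocallyCompactSpace G]
    {S : E → G} (hS : IsLocalHomeomorph S)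
    (hp : Filter.Tendsto S (Filter.cocompact E) (Filter.cocompact G)) :
    Function.Bijective S := by
  have hprop : IsProperMap S := isProperMap_iff_tendsto_cocompact.2 ⟨hS.continuous, hp⟩
  have hcov : IsCoveringMap S := by
    rw [isCoveringMap_iff_isCoveringMapOn_univ]
    refine hprop.isClosedMap.isCoveringMapOn_of_isLocalHomeomorphOn (fun x _ => ?_)
      (fun x _ => hS x)
    refine (hprop.isCompact_preimage isCompact_singleton).finite
      (IsDiscrete.of_openPartialHomeomorph S subset_rfl fun e _ => ?_)
    obtain ⟨φ, h, h'⟩ := hS e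
    exact ⟨φ, h, h'.symm⟩
  have hLP : LocallyPathConnectedSpace G := inferInstance
  obtain ⟨T, ⟨hT0, hST⟩, -⟩ := hcov.existsUnique_continuousMap_lifts
    (ContinuousMap.id G) (S 0) 0 rfl
  have hST' : ∀ y, S (T y) = y := fun y => congrFun hST y
  have hTS : T ∘ S = id := hcov.eq_of_comp_eq (T.continuous.comp hS.continuous) continuous_id
    (by ext x; simp [hST']) 0 (by simpa using hT0)
  exact ⟨Function.LeftInverse.injective (g := T) fun x => congrFun hTS x,
    Function.RightInverse.surjective (g := T) hST'⟩

end ProperLocalHomeomorph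

/-! ### Quasi-periodic maps -/

section QuasiPeriodic

variable {d : ℕ} {G : Type*} [NormedAddCommGroup G] [NormedSpace ℝ G]

/-- The point of the lattice `ℤ^d ⊆ ℝ^d` with coordinates `z`. -/
noncomputable def latticePoint (z : Fin d → ℤ) : Coord d := WithLp.toLp 2 fun i => (z i : ℝ)

/-- The linear map sending the standard basis to the family `p`. -/
noncomputable def periodMap (p : Fin d → G) : Coord d →L[ℝ] G :=
  ∑ j, (EuclideanSpace.proj j : Coord d →L[ℝ] ℝ).smulRight (p j)

theorem periodMap_apply (p : Fin d → G) (u : Coord d) : periodMap p u = ∑ j, u j • p j := by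
  simp [periodMap]

theorem periodMap_latticePoint (p : Fin d → G) (z : Fin d → ℤ) :
    periodMap p (latticePoint z) = ∑ j, (z j : ℝ) • p j := by
  simp [periodMap_apply, latticePoint]

theorem exists_sub_latticePoint_mem (θ : Coord d) :
    ∃ z : Fin d → ℤ, ∀ i, (θ - latticePoint z) i ∈ Icc (0 : ℝ) 1 :=
  ⟨fun i => ⌊θ i⌋, fun i => by
    simpa [latticePoint] using (Int.fract_lt_one (θ i)).le⟩

theorem isCompact_unitCube : IsCompact {θ : Coord d | ∀ i, θ i ∈ Icc (0 : ℝ) 1} := by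
  have h : {θ : Coord d | ∀ i, θ i ∈ Icc (0 : ℝ) 1} =
      (EuclideanSpace.equiv (Fin d) ℝ).toHomeomorph ⁻¹' (univ.pi fun _ => Icc (0 : ℝ) 1) := by
    ext θ; simp only [mem_ofPred_eq, mem_preimage, mem_univ_pi]; rfl
  rw [h, Homeomorph.isCompact_preimage]
  exact isCompact_univ_pi fun _ => isCompact_Icc

variable {S : Coord d → G} {p : Fin d → G}

/-- The difference of `S` and its linear part is `ℤ^d`-periodic, so its bound on the unit cube is
global. -/
theorem exists_norm_sub_periodMap_le (hc : Continuous S)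
    (hq : ∀ θ z, S (θ + latticePoint z) = S θ + periodMap p (latticePoint z)) :
    ∃ C, ∀ θ, ‖S θ - periodMap p θ‖ ≤ C := by
  obtain ⟨C, hC⟩ := (isCompact_unitCube (d := d)).exists_bound_of_continuousOn
    (f := fun θ => S θ - periodMap p θ) (hc.sub (periodMap p).continuous).continuousOn
  refine ⟨C, fun θ => ?_⟩
  obtain ⟨z, hz⟩ := exists_sub_latticePoint_mem θ
  have h := hC _ hz
  have h2 := hq (θ - latticePoint z) z
  rw [sub_add_cancel] at h2
  rw [h2]
  rwa [map_sub, sub_sub_eq_add_sub] at h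

/-- The range contains a neighbourhood of uniform radius `r` of the image of the unit cube.
Translating by periods, every point of the range is the centre of an `r`-ball inside the range,
which is thus closed as well as open. -/
theorem surjective_of_isOpenMap_of_quasiPeriodic (hc : Continuous S) (ho : IsOpenMap S)
    (hq : ∀ θ z, S (θ + latticePoint z) = S θ + periodMap p (latticePoint z)) :
    Function.Surjective S := by
  obtain ⟨r, hr, hrS⟩ := ((isCompact_unitCube (d := d)).image hc).exists_thickening_subset_open
    ho.isOpen_range (image_subset_range _ _)
  have hball : ∀ y ∈ range S, Metric.ball y r ⊆ range S := by
    rintro _ ⟨θ, rfl⟩ y hy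
    obtain ⟨z, hz⟩ := exists_sub_latticePoint_mem θ
    have h2 := hq (θ - latticePoint z) z
    rw [sub_add_cancel] at h2
    have : y - periodMap p (latticePoint z) ∈ range S := by
      refine hrS (Metric.mem_thickening_iff.2 ⟨S (θ - latticePoint z), ⟨_, hz, rfl⟩, ?_⟩)
      rw [Metric.mem_ball, h2] at hy
      rw [dist_eq_norm] at hy ⊢
      convert hy using 2
      abel
    obtain ⟨θ', hθ'⟩ := this
    exact ⟨θ' + latticePoint z, by rw [hq, hθ', sub_add_cancel]⟩
  have hclosed : IsClosed (range S) := by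
    rw [← closure_subset_iff_isClosed]
    intro y hy
    obtain ⟨y', hy', hd⟩ := Metric.mem_closure_iff.1 hy r hr
    exact hball y' hy' hd
  exact range_eq_univ.1 (IsClopen.eq_univ ⟨hclosed, ho.isOpen_range⟩ (range_nonempty S))

/-- Otherwise a nonzero functional `ℓ` kills the range of the linear part, and `ℓ ∘ S` is bounded
although `S` is onto. -/
theorem periodMap_surjective [FiniteDimensional ℝ G] (hs : Function.Surjective S) {C : ℝ}
    (hC : ∀ θ, ‖S θ - periodMap p θ‖ ≤ C) : Function.Surjective (periodMap p) := by
  by_contra hns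
  have hlt : (periodMap p).toLinearMap.range < ⊤ :=
    lt_top_iff_ne_top.2 fun h => hns (LinearMap.range_eq_top.1 h)
  obtain ⟨ℓ, hℓ, hle⟩ := Submodule.exists_le_ker_of_lt_top _ hlt
  obtain ⟨g, hg⟩ : ∃ g, ℓ g ≠ 0 := by
    by_contra! h
    exact hℓ (LinearMap.ext h)
  let ℓ' : G →L[ℝ] ℝ := LinearMap.toContinuousLinearMap ℓ
  -- The point is scaled so that `ℓ` takes there the value `‖ℓ'‖ * C + 1`, one more than the bound
  -- allows.
  obtain ⟨θ, hθ⟩ := hs (((‖ℓ'‖ * C + 1) / ℓ g) • g)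
  have h1 : ℓ' (S θ - periodMap p θ) = ‖ℓ'‖ * C + 1 := by
    have h2 : ℓ (periodMap p θ) = 0 := hle ⟨θ, rfl⟩
    change ℓ _ = _
    rw [map_sub, h2, hθ, map_smul, smul_eq_mul, div_mul_cancel₀ _ hg, sub_zero]
  have h3 := ℓ'.le_of_opNorm_le le_rfl (S θ - periodMap p θ)
  have h4 := mul_le_mul_of_nonneg_left (hC θ) (norm_nonneg ℓ')
  rw [h1] at h3
  linarith [le_abs_self (‖ℓ'‖ * C + 1), Real.norm_eq_abs (‖ℓ'‖ * C + 1)]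

theorem linearIndependent_of_periodMap_surjective [FiniteDimensional ℝ G]
    (hG : Module.finrank ℝ G = d)
    (hs : Function.Surjective (periodMap p)) : LinearIndependent ℝ p := by
  refine linearIndependent_of_top_le_span_of_card_eq_finrank ?_ (by simp [hG])
  intro g _
  obtain ⟨u, rfl⟩ := hs g
  rw [periodMap_apply]
  exact Submodule.sum_mem _ fun j _ =>
    Submodule.smul_mem _ _ (Submodule.subset_span (mem_range_self j))

/-- An injective linear map in finite dimension is antilipschitz, hence proper, and `S` is within
`C` of one. -/
theorem tendsto_cocompact_of_quasiPeriodic [FiniteDimensional ℝ G]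
    (hi : Function.Injective (periodMap p)) {C : ℝ}
    (hC : ∀ θ, ‖S θ - periodMap p θ‖ ≤ C) :
    Filter.Tendsto S (Filter.cocompact _) (Filter.cocompact G) := by
  obtain ⟨K, hK, hKp⟩ := (periodMap p).toLinearMap.exists_antilipschitzWith
    (LinearMap.ker_eq_bot.2 hi)
  have h1 : Filter.Tendsto (fun θ : Coord d => ‖periodMap p θ‖) (Filter.cocompact _)
      Filter.atTop := by
    have := hKp.tendsto_cobounded
    rw [Metric.cobounded_eq_cocompact, Metric.cobounded_eq_cocompact] at this
    exact (tendsto_norm_cocompact_atTop).comp this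
  rw [← Metric.cobounded_eq_cocompact (α := G), ← tendsto_norm_atTop_iff_cobounded]
  refine Filter.tendsto_atTop_mono (fun θ => ?_)
    (Filter.tendsto_atTop_add_const_right _ (-C) h1)
  have := norm_sub_norm_le (periodMap p θ) (S θ)
  have h2 := hC θ
  rw [norm_sub_rev] at h2
  linarith

end QuasiPeriodic

/-! ### The developing map of a closed periodic 1-form -/

section Developing

variable {d : ℕ} {G : Type*} [NormedAddCommGroup G] [NormedSpace ℝ G]

theorem latticePoint_single (j : Fin d) :
    latticePoint (Pi.single j 1) = EuclideanSpace.single j (1 : ℝ) := by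
  ext i
  simp [latticePoint, Pi.single_apply]

theorem latticePoint_add (z z' : Fin d → ℤ) :
    latticePoint (z + z') = latticePoint z + latticePoint z' := by
  ext i
  simp [latticePoint]

/-- A map whose derivative is `ℤ^d`-periodic is quasi-periodic. -/
theorem quasiPeriodic_of_hasFDerivAt {S : Coord d → G} {a : Coord d → Coord d →L[ℝ] G}
    (hS : ∀ θ, HasFDerivAt S (a θ) θ) (hper : ∀ θ z, a (θ + latticePoint z) = a θ)
    (θ : Coord d) (z : Fin d → ℤ) :
    S (θ + latticePoint z) = S θ +
      periodMap (fun j => S (EuclideanSpace.single j 1) - S 0) (latticePoint z) := by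
  -- The increment of `S` under a lattice translation has zero derivative, so it does not depend on
  -- the base point.
  have hconst : ∀ z θ, S (θ + latticePoint z) - S θ = S (latticePoint z) - S 0 := by
    intro z θ
    have hd : ∀ θ, HasFDerivAt (fun θ => S (θ + latticePoint z) - S θ)
        (0 : Coord d →L[ℝ] G) θ := fun θ => by
      have h1 := ((hS (θ + latticePoint z)).comp θ
        ((hasFDerivAt_id θ).add_const (latticePoint z))).sub (hS θ)
      have h2 : (a (θ + latticePoint z)).comp (ContinuousLinearMap.id ℝ (Coord d)) - a θ = 0 := by
        rw [hper, ContinuousLinearMap.comp_id, sub_self]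
      exact h2 ▸ h1
    have := is_const_of_fderiv_eq_zero (𝕜 := ℝ) (fun θ => (hd θ).differentiableAt)
      (fun θ => (hd θ).fderiv) θ 0
    simpa using this
  -- Hence the increment is additive in `z`, and is determined by its values on the standard basis.
  let c : (Fin d → ℤ) →+ G :=
    { toFun := fun z => S (latticePoint z) - S 0
      map_zero' := by
        have : latticePoint (0 : Fin d → ℤ) = 0 := by ext i; simp [latticePoint]
        simp [this]
      map_add' := fun z z' => by
        rw [add_comm z z', latticePoint_add, ← hconst z (latticePoint z')]
        abel }
  have hc : c z = periodMap (fun j => S (EuclideanSpace.single j 1) - S 0) (latticePoint z) := by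
    rw [periodMap_latticePoint]
    have hz : z = ∑ j, z j • (Pi.single j 1 : Fin d → ℤ) := by
      ext i
      simp [Finset.sum_apply, Pi.single_apply]
    conv_lhs => rw [hz]
    rw [map_sum]
    refine Finset.sum_congr rfl fun j _ => ?_
    rw [map_zsmul, Int.cast_smul_eq_zsmul]
    congr 1
    change S (latticePoint _) - S 0 = _
    rw [latticePoint_single]
  rw [← hc]
  change _ = S θ + (S (latticePoint z) - S 0)
  rw [← hconst z θ]
  abel

/-- The developing map of a closed periodic nondegenerate 1-form on `ℝ^d` is a diffeomorphism
which conjugates the translations by `ℤ^d` to the translations by the periods of the form. -/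
theorem exists_developing [FiniteDimensional ℝ G] (hG : Module.finrank ℝ G = d)
    {a : Coord d → Coord d →L[ℝ] G} (ha : ContDiff ℝ 1 a)
    (hper : ∀ θ z, a (θ + latticePoint z) = a θ) (hinj : ∀ θ, Function.Injective (a θ))
    (hcl : ∀ θ v w, fderiv ℝ a θ v w = fderiv ℝ a θ w v) {p : Fin d → G}
    (hp : ∀ j, p j = ∫ t in (0 : ℝ)..1,
      a (t • EuclideanSpace.single j 1) (EuclideanSpace.single j 1)) :
    LinearIndependent ℝ p ∧ ∃ (S : Coord d → G) (T : G → Coord d),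
      (∀ θ, T (S θ) = θ) ∧ (∀ s, S (T s) = s) ∧
      (∀ θ z, S (θ + latticePoint z) = S θ + periodMap p (latticePoint z)) ∧
      ∀ s, ∃ A : Coord d ≃L[ℝ] G, (A : Coord d →L[ℝ] G) = a (T s) ∧
        HasFDerivAt T (A.symm : G →L[ℝ] Coord d) s := by
  obtain ⟨S, hS⟩ := convex_univ.exists_forall_hasFDerivAt_of_fderiv_symmetric isOpen_univ
    (ha.differentiable one_ne_zero).differentiableOn (fun θ _ => hcl θ)
  replace hS : ∀ θ, HasFDerivAt S (a θ) θ := fun θ => hS θ (mem_univ _)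
  have hSc : Continuous S := continuous_iff_continuousAt.2 fun θ => (hS θ).continuousAt
  -- By the fundamental theorem of calculus, the integral of the form along the `j`-th edge of the
  -- cube is the increment of its primitive.
  have hpS : p = fun j => S (EuclideanSpace.single j 1) - S 0 := by
    ext1 j
    have hd : ∀ t : ℝ, HasDerivAt (fun t : ℝ => S (t • EuclideanSpace.single j (1 : ℝ)))
        (a (t • EuclideanSpace.single j 1) (EuclideanSpace.single j 1)) t := fun t => by
      have h1 : HasDerivAt (fun t : ℝ => t • (EuclideanSpace.single j (1 : ℝ) : Coord d))
          ((1 : ℝ) • EuclideanSpace.single j (1 : ℝ)) t := (hasDerivAt_id t).smul_const _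
      rw [one_smul] at h1
      exact (hS _).comp_hasDerivAt t h1
    rw [hp, intervalIntegral.integral_eq_sub_of_hasDerivAt (fun t _ => hd t)]
    · simp
    · have := ha.continuous
      exact Continuous.intervalIntegrable (by fun_prop) _ _
  have hq : ∀ θ z, S (θ + latticePoint z) = S θ + periodMap p (latticePoint z) := fun θ z => by
    rw [hpS]
    exact quasiPeriodic_of_hasFDerivAt hS hper θ z
  let A : Coord d → (Coord d ≃L[ℝ] G) := fun θ =>
    (LinearEquiv.ofInjectiveOfFinrankEq (a θ).toLinearMap (hinj θ)
      (by simp [hG])).toContinuousLinearEquiv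
  have hA : ∀ θ, (A θ : Coord d →L[ℝ] G) = a θ := fun θ => by
    ext v; rfl
  have hstrict : ∀ θ, HasStrictFDerivAt S (A θ : Coord d →L[ℝ] G) θ := fun θ => by
    rw [hA]
    exact hasStrictFDerivAt_of_hasFDerivAt_of_continuousAt (Filter.Eventually.of_forall hS)
      ha.continuous.continuousAt
  have hloc : IsLocalHomeomorph S := fun θ =>
    ⟨(hstrict θ).toOpenPartialHomeomorph S, (hstrict θ).mem_toOpenPartialHomeomorph_source, rfl⟩
  obtain ⟨C, hC⟩ := exists_norm_sub_periodMap_le hSc hq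
  have hsurj := periodMap_surjective
    (surjective_of_isOpenMap_of_quasiPeriodic hSc hloc.isOpenMap hq) hC
  have hPi : Function.Injective (periodMap p) :=
    ((LinearMap.injective_iff_surjective_of_finrank_eq_finrank (f := (periodMap p).toLinearMap)
      (by simp [hG])).2 hsurj)
  have hbij := bijective_of_isLocalHomeomorph_of_tendsto_cocompact hloc
    (tendsto_cocompact_of_quasiPeriodic hPi hC)
  let e := (Equiv.ofBijective S hbij)
  have hes : Continuous e.symm :=
    (e.toHomeomorphOfContinuousOpen hSc hloc.isOpenMap).symm.continuous
  refine ⟨linearIndependent_of_periodMap_surjective hG hsurj, S, e.symm,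
    e.symm_apply_apply, e.apply_symm_apply, hq, fun s => ⟨A (e.symm s), hA _, ?_⟩⟩
  exact HasFDerivAt.of_local_left_inverse hes.continuousAt (hstrict (e.symm s)).hasFDerivAt
    (Filter.Eventually.of_forall e.apply_symm_apply)

end Developing

/-! ### Ergodicity of nonresonant linear flows -/

section TorusErgodicity

open UnitAddTorus

attribute [local instance] instMeasureSpaceUnitAddCircle
  instIsAddHaarMeasureUnitAddCircleVolume instIsProbabilityMeasureUnitAddCircleVolume

variable {ι : Type*} [Fintype ι]

theorem mFourier_apply_add (n : ι → ℤ) (τ s : UnitAddTorus ι) :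
    mFourier n (τ + s) = mFourier n τ * mFourier n s := by
  simp only [mFourier, ContinuousMap.coe_mk, Pi.add_apply, ← Finset.prod_mul_distrib]
  exact Finset.prod_congr rfl fun i _ => by simp [fourier_apply, smul_add, AddCircle.toCircle_add]

theorem mFourier_coe (n : ι → ℤ) (s : ι → ℝ) :
    mFourier n (fun i => (s i : UnitAddCircle)) =
      Complex.exp (2 * Real.pi * Complex.I * ((∑ i, n i * s i : ℝ) : ℂ)) := by
  simp only [mFourier, ContinuousMap.coe_mk, fourier_coe_apply, ← Complex.exp_sum]
  congr 1
  push_cast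
  rw [Finset.mul_sum]
  exact Finset.sum_congr rfl fun i _ => by ring

/-- A linear flow on the torus `ℝ^ι / ℤ^ι` whose frequency is rationally independent is ergodic. -/
theorem ergodic_linear_flow {ν : ι → ℝ} (hν : ∀ n : ι → ℤ, n ≠ 0 → ∑ i, n i * ν i ≠ 0)
    {A : Set (UnitAddTorus ι)} (hA : MeasurableSet A)
    (hinv : ∀ t : ℝ, (fun τ : UnitAddTorus ι => τ + fun i => ((t * ν i : ℝ) : UnitAddCircle)) ⁻¹' A
      =ᵐ[volume] A) :
    volume A = 0 ∨ volume Aᶜ = 0 := by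
  set f : UnitAddTorus ι → ℂ := A.indicator fun _ => 1 with hf
  let F : Lp ℂ 2 (volume : Measure (UnitAddTorus ι)) :=
    indicatorConstLp 2 hA (measure_ne_top _ _) (1 : ℂ)
  have hF : F =ᵐ[volume] f := indicatorConstLp_coeFn
  have hcoeff : ∀ n, mFourierCoeff F n = mFourierCoeff f n := fun n =>
    integral_congr_ae (by filter_upwards [hF] with x hx; rw [hx])
  have hzero : ∀ n : ι → ℤ, n ≠ 0 → mFourierCoeff f n = 0 := by
    intro n hn
    have hq := hν n hn
    obtain ⟨q, hqdef⟩ : ∃ q, q = ∑ i, n i * ν i := ⟨_, rfl⟩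
    rw [← hqdef] at hq
    -- With `q` the frequency of the `n`-th character, the translation at time `1 / (2 * q)`
    -- multiplies the character of index `-n` by `exp (-π i) = -1`. Invariance of `A` then makes the
    -- coefficient equal to its own opposite.
    set s : UnitAddTorus ι := fun i => ((1 / (2 * q) * ν i : ℝ) : UnitAddCircle) with hs
    have hm : mFourier (-n) s = -1 := by
      rw [hs, mFourier_coe, ← Complex.exp_neg_pi_mul_I]
      congr 1
      have : ∑ i, ((-n) i : ℤ) * (1 / (2 * q) * ν i) = -(1 / 2) := by
        have h2 : ∑ i, ((-n) i : ℤ) * (1 / (2 * q) * ν i) = -(1 / (2 * q)) * q := by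
          conv_rhs => rw [hqdef, Finset.mul_sum]
          rw [← hqdef]
          exact Finset.sum_congr rfl fun i _ => by simp only [Pi.neg_apply]; push_cast; ring
        rw [h2]; field_simp
      rw [this]
      push_cast
      ring
    have h1 : mFourierCoeff f n = -mFourierCoeff f n := by
      calc mFourierCoeff f n = ∫ τ, mFourier (-n) (τ + s) • f (τ + s) :=
            (integral_add_right_eq_self (fun τ => mFourier (-n) τ • f τ) s).symm
        _ = ∫ τ, -(mFourier (-n) τ • f τ) := by
            refine integral_congr_ae ?_
            filter_upwards [hinv (1 / (2 * q))] with τ hτ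
            have hτ' : f (τ + s) = f τ := by
              have : τ + s ∈ A ↔ τ ∈ A := iff_of_eq hτ
              by_cases h : τ ∈ A
              · rw [hf, indicator_of_mem h, indicator_of_mem (this.mpr h)]
              · rw [hf, indicator_of_notMem h, indicator_of_notMem fun h' => h (this.mp h')]
            rw [mFourier_apply_add, hm, hτ']
            simp
        _ = -mFourierCoeff f n := integral_neg _
    exact CharZero.eq_neg_self_iff.1 h1
  have h0 : mFourierCoeff f 0 = (volume.real A : ℂ) := by
    simp [mFourierCoeff, mFourier_zero, hf, integral_indicator hA]
  -- Only the zeroth coefficient survives, so Parseval reads `volume A = (volume A) ^ 2`.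
  have hsum := hasSum_sq_mFourierCoeff F
  have hnorm : ∫ t, ‖F t‖ ^ 2 = volume.real A := by
    calc ∫ t, ‖F t‖ ^ 2 = ∫ t, A.indicator (fun _ => (1 : ℝ)) t := by
          refine integral_congr_ae ?_
          filter_upwards [hF] with x hx
          rw [hx, hf]
          by_cases h : x ∈ A <;> simp [h]
      _ = volume.real A := by simp [integral_indicator hA]
  have hsingle : HasSum (fun n => ‖mFourierCoeff F n‖ ^ 2) (‖mFourierCoeff F 0‖ ^ 2) :=
    hasSum_single 0 fun n hn => by simp [hcoeff, hzero n hn]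
  have hsq := hsum.unique hsingle
  rw [hnorm, hcoeff, h0, Complex.norm_real, Real.norm_eq_abs, sq_abs] at hsq
  have hcases : volume.real A = 0 ∨ volume.real A = 1 := by
    have : volume.real A * (volume.real A - 1) = 0 := by linarith [sq (volume.real A)]
    rcases mul_eq_zero.1 this with h | h
    · exact Or.inl h
    · exact Or.inr (by linarith)
  rcases hcases with h | h
  · exact Or.inl ((measureReal_eq_zero_iff).1 h)
  · right
    have : volume.real Aᶜ = 0 := by rw [probReal_compl_eq_one_sub hA, h, sub_self]
    exact (measureReal_eq_zero_iff).1 this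

end TorusErgodicity

/-! ### Pulling back the symplectic form by local diffeomorphisms -/

section PullbackForm

variable {n : ℕ} {M : Type*} [TopologicalSpace M] [ChartedSpace (Coord n) M]
  {V : Type*} [NormedAddCommGroup V] [NormedSpace ℝ V]

/-- The symplectic form at a point, as a form on the model space. -/
noncomputable def SymplecticForm.formAt (σ : SymplecticForm n M) (m : M) :
    Coord n [⋀^Fin 2]→L[ℝ] ℝ := σ.form m

/-- The derivative of a map from a vector space to a manifold, with values in the model space. -/
noncomputable def modelDeriv (G : V → M) (q : V) : V →L[ℝ] Coord n :=
  mfderiv 𝓘(ℝ, V) 𝓘(ℝ, Coord n) G q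

theorem modelDeriv_congr {G G' : V → M} {q : V} (h : G =ᶠ[𝓝 q] G') :
    modelDeriv (n := n) G q = modelDeriv G' q :=
  h.mfderiv_eq

/-- The pullback of a symplectic form by a map from a vector space. -/
noncomputable def SymplecticForm.pullback (σ : SymplecticForm n M) (G : V → M) (q : V) :
    V [⋀^Fin 2]→L[ℝ] ℝ :=
  (σ.formAt (G q)).compContinuousLinearMap (modelDeriv G q)

theorem SymplecticForm.pullback_apply (σ : SymplecticForm n M) (G : V → M) (q v w : V) :
    σ.pullback G q ![v, w] = σ.formAt (G q) ![modelDeriv G q v, modelDeriv G q w] := by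
  rw [SymplecticForm.pullback, ContinuousAlternatingMap.compContinuousLinearMap_apply]
  congr 1
  ext1 i
  fin_cases i <;> rfl

theorem SymplecticForm.pullback_congr (σ : SymplecticForm n M) {G G' : V → M} {q : V}
    (h : G =ᶠ[𝓝 q] G') : σ.pullback G q = σ.pullback G' q := by
  rw [SymplecticForm.pullback, SymplecticForm.pullback, modelDeriv_congr h, h.eq_of_nhds]

/-- A local inverse of `G` is a chart of the smooth structure, and it is in such charts that
smoothness and closedness of the form are given. -/
theorem exists_mem_maximalAtlas_of_isLocalDiffeomorphAt [IsManifold 𝓘(ℝ, Coord n) ∞ M]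
    {G : Coord n → M} {y : Coord n}
    (hG : IsLocalDiffeomorphAt 𝓘(ℝ, Coord n) 𝓘(ℝ, Coord n) ∞ G y) :
    ∃ e ∈ IsManifold.maximalAtlas 𝓘(ℝ, Coord n) ∞ M, y ∈ e.target ∧ EqOn e.symm G e.target := by
  obtain ⟨Φ, hy, hΦ⟩ := hG
  refine ⟨Φ.symm.toOpenPartialHomeomorph, ?_, hy, fun x hx => (hΦ hx).symm⟩
  exact OpenPartialHomeomorph.mem_maximalAtlas_of_contMDiffOn _ Φ.contMDiffOn_invFun
    Φ.contMDiffOn_toFun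

theorem SymplecticForm.pullback_coord [IsManifold 𝓘(ℝ, Coord n) ∞ M]
    (σ : SymplecticForm n M) {G : Coord n → M} {y : Coord n}
    (hG : IsLocalDiffeomorphAt 𝓘(ℝ, Coord n) 𝓘(ℝ, Coord n) ∞ G y) :
    ContDiffAt ℝ ∞ (σ.pullback G) y ∧ extDeriv (σ.pullback G) y = 0 := by
  obtain ⟨e, he, hy, hG⟩ := exists_mem_maximalAtlas_of_isLocalDiffeomorphAt hG
  have hmem := e.open_target.mem_nhds hy
  have h : σ.pullback G =ᶠ[𝓝 y] chartForm σ.form e := by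
    filter_upwards [hmem] with q hq
    rw [σ.pullback_congr (Filter.eventuallyEq_of_mem (e.open_target.mem_nhds hq) hG.symm)]
    rfl
  exact ⟨((σ.smooth e he).contDiffAt hmem).congr_of_eventuallyEq h,
    h.extDeriv_eq.trans (σ.closed e he y hy)⟩

theorem SymplecticForm.pullback_of_isLocalDiffeomorphAt [IsManifold 𝓘(ℝ, Coord n) ∞ M]
    (σ : SymplecticForm n M) {G : V → M} {s : Set V} (hs : IsOpen s)
    (hG : ∀ q ∈ s, IsLocalDiffeomorphAt 𝓘(ℝ, V) 𝓘(ℝ, Coord n) ∞ G q) {p : V} (hp : p ∈ s) :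
    ContDiffAt ℝ ∞ (σ.pullback G) p ∧ extDeriv (σ.pullback G) p = 0 := by
  -- The derivative at `p` serves only as some linear identification of `V` with the model space;
  -- the general case then follows from `pullback_coord` by a linear change of variables.
  let L : V ≃L[ℝ] Coord n := (hG p hp).mfderivToContinuousLinearEquiv (by simp)
  have hL : IsLocalDiffeomorphAt 𝓘(ℝ, Coord n) 𝓘(ℝ, V) ∞ L.symm (L p) :=
    L.symm.toDiffeomorph.isLocalDiffeomorph (L p)
  have hGL : IsLocalDiffeomorphAt 𝓘(ℝ, Coord n) 𝓘(ℝ, Coord n) ∞ (G ∘ L.symm) (L p) :=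
    hL.comp 𝓘(ℝ, Coord n) M (by rw [L.symm_apply_apply]; exact hG p hp)
  obtain ⟨h1, h2⟩ := σ.pullback_coord hGL
  have h : σ.pullback G =ᶠ[𝓝 p] fun q =>
      (σ.pullback (G ∘ L.symm) (L q)).compContinuousLinearMap (fderiv ℝ L q) := by
    filter_upwards [hs.mem_nhds hp] with q hq
    have hd : modelDeriv (n := n) (G ∘ L.symm) (L q) = (modelDeriv G q).comp (L.symm : Coord n →L[ℝ] V) := by
      have h3 := (hG q hq).mdifferentiableAt (by simp)
      have h4 : HasMFDerivAt 𝓘(ℝ, Coord n) 𝓘(ℝ, V) L.symm (L q) (L.symm : Coord n →L[ℝ] V) :=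
        L.symm.hasFDerivAt.hasMFDerivAt
      rw [← L.symm_apply_apply q] at h3
      have h5 := (h3.hasMFDerivAt.comp (L q) h4).mfderiv
      rw [L.symm_apply_apply] at h5
      exact h5
    have hGq : (G ∘ L.symm) (L q) = G q := by simp
    rw [SymplecticForm.pullback, SymplecticForm.pullback, hd, hGq, L.fderiv]
    ext v
    simp only [ContinuousAlternatingMap.compContinuousLinearMap_apply]
    congr 1
    ext1 i
    simp
  refine ⟨ContDiffAt.congr_of_eventuallyEq ?_ h, ?_⟩
  · simp only [L.fderiv]
    exact (ContinuousAlternatingMap.compContinuousLinearMapCLM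
      (L : V →L[ℝ] Coord n)).contDiff.contDiffAt.comp p (h1.comp p L.contDiff.contDiffAt)
  · rw [h.extDeriv_eq, extDeriv_pullback (r := 2) (h1.differentiableAt (by simp))
      L.contDiff.contDiffAt (by simp), h2]
    ext v
    simp

theorem extDeriv_two_apply {η : V → V [⋀^Fin 2]→L[ℝ] ℝ} {p : V} (hη : DifferentiableAt ℝ η p)
    (u v w : V) : extDeriv η p ![u, v, w] = fderiv ℝ (fun q => η q ![v, w]) p u -
      fderiv ℝ (fun q => η q ![u, w]) p v + fderiv ℝ (fun q => η q ![u, v]) p w := by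
  have h0 : (0 : Fin 3).removeNth ![u, v, w] = ![v, w] := by ext i; fin_cases i <;> rfl
  have h1 : (1 : Fin 3).removeNth ![u, v, w] = ![u, w] := by ext i; fin_cases i <;> rfl
  have h2 : (2 : Fin 3).removeNth ![u, v, w] = ![u, v] := by ext i; fin_cases i <;> rfl
  rw [extDeriv_apply hη, Fin.sum_univ_three, h0, h1, h2]
  simp [sub_eq_add_neg]

end PullbackForm

/-! ### Alternating 2-forms as bilinear maps -/

section AlternatingForm

variable {V : Type*} [NormedAddCommGroup V] [NormedSpace ℝ V]

theorem alternating_swap (η : V [⋀^Fin 2]→L[ℝ] ℝ) (v w : V) : η ![v, w] = -η ![w, v] := by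
  have h := η.toAlternatingMap.map_swap ![w, v] (show (0 : Fin 2) ≠ 1 by simp)
  have h2 : ![w, v] ∘ Equiv.swap (0 : Fin 2) 1 = ![v, w] := by ext i; fin_cases i <;> rfl
  rw [h2] at h
  exact h

/-- An alternating 2-form as a bilinear map. -/
noncomputable def alternatingBilin (η : V [⋀^Fin 2]→L[ℝ] ℝ) : V →ₗ[ℝ] V →ₗ[ℝ] ℝ :=
  LinearMap.mk₂ ℝ (fun u v => η ![u, v])
    (fun u u' v => η.toMultilinearMap.cons_add ![v] u u')
    (fun c u v => η.toMultilinearMap.cons_smul ![v] c u)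
    (fun u v v' => by
      have h : η ![v + v', u] = η ![v, u] + η ![v', u] :=
        η.toMultilinearMap.cons_add ![u] v v'
      rw [alternating_swap η u, alternating_swap η u, alternating_swap η u, h]
      ring)
    (fun c u v => by
      have h : η ![c • v, u] = c • η ![v, u] := η.toMultilinearMap.cons_smul ![u] c v
      rw [alternating_swap η u, alternating_swap η u, h, smul_neg])

theorem alternatingBilin_apply (η : V [⋀^Fin 2]→L[ℝ] ℝ) (u v : V) :
    alternatingBilin η u v = η ![u, v] := rfl

end AlternatingForm

/-! ### The symplectic form in a local trivialization -/

section LocalModel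

variable {d : ℕ} {M : Type*} [TopologicalSpace M] [ChartedSpace (Coord (2 * d)) M]
  {B : Type*} [TopologicalSpace B] [ChartedSpace (Coord d) B]

/-- A local trivialization of a torus fibration over a coordinate domain `D` of the base,
lifted to the universal covers of the fibres. -/
structure IsLocalModel (π : M → B) (D : Set (Coord d)) (h : Coord d → B)
    (Ψ : Coord d × Coord d → M) : Prop where
  isOpen : IsOpen D
  diffeo : ∀ p ∈ D ×ˢ (univ : Set (Coord d)),
    IsLocalDiffeomorphAt 𝓘(ℝ, Coord d × Coord d) 𝓘(ℝ, Coord (2 * d)) ∞ Ψ p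
  base : ∀ x ∈ D, IsLocalDiffeomorphAt 𝓘(ℝ, Coord d) 𝓘(ℝ, Coord d) ∞ h x
  proj : ∀ x ∈ D, ∀ θ, π (Ψ (x, θ)) = h x
  surj : ∀ x ∈ D, ∀ m, π m = h x → ∃ θ, Ψ (x, θ) = m
  fibre : ∀ x ∈ D, ∀ θ θ', Ψ (x, θ) = Ψ (x, θ') ↔ ∃ z, θ' = θ + latticePoint z

/-- The mixed part of the symplectic form in a local model. -/
noncomputable def mixedForm (σ : SymplecticForm (2 * d) M) (Ψ : Coord d × Coord d → M)
    (p : Coord d × Coord d) : Coord d →L[ℝ] Coord d →L[ℝ] ℝ :=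
  LinearMap.toContinuousBilinearMap ((alternatingBilin (σ.pullback Ψ p)).compl₁₂
    (LinearMap.inr ℝ (Coord d) (Coord d)) (LinearMap.inl ℝ (Coord d) (Coord d)))

theorem mixedForm_apply (σ : SymplecticForm (2 * d) M) (Ψ : Coord d × Coord d → M)
    (p : Coord d × Coord d) (w u : Coord d) :
    mixedForm σ Ψ p w u = σ.pullback Ψ p ![(0, w), (u, 0)] := rfl

variable {π : M → B} {σ : SymplecticForm (2 * d) M}
  {D : Set (Coord d)} {h : Coord d → B} {Ψ : Coord d × Coord d → M}

theorem IsLocalModel.isOpen_prod (hm : IsLocalModel π D h Ψ) :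
    IsOpen (D ×ˢ (univ : Set (Coord d))) := hm.isOpen.prod isOpen_univ

theorem IsLocalModel.bijective_modelDeriv (hm : IsLocalModel π D h Ψ)
    {p : Coord d × Coord d} (hp : p.1 ∈ D) :
    Function.Bijective (modelDeriv (n := 2 * d) Ψ p) :=
  ((hm.diffeo p ⟨hp, mem_univ _⟩).mfderivToContinuousLinearEquiv (by simp)).bijective

theorem IsLocalModel.modelDeriv_add (hm : IsLocalModel π D h Ψ)
    {p : Coord d × Coord d} (hp : p.1 ∈ D) (z : Fin d → ℤ) :
    modelDeriv (n := 2 * d) Ψ (p + (0, latticePoint z)) = modelDeriv (n := 2 * d) Ψ p := by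
  have h1 : Ψ ∘ (fun q => q + (0, latticePoint z)) =ᶠ[𝓝 p] Ψ := by
    filter_upwards [hm.isOpen_prod.mem_nhds (show p ∈ D ×ˢ univ from ⟨hp, mem_univ _⟩)] with q hq
    have := (hm.fibre q.1 hq.1 q.2 (q.2 + latticePoint z)).2 ⟨z, rfl⟩
    rw [Function.comp_apply, show q + (0, latticePoint z) = (q.1, q.2 + latticePoint z) from
      Prod.ext (by simp) rfl, ← this]
  have h2 : HasMFDerivAt 𝓘(ℝ, Coord d × Coord d) 𝓘(ℝ, Coord d × Coord d)
      (fun q : Coord d × Coord d => q + (0, latticePoint z)) p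
      (ContinuousLinearMap.id ℝ (Coord d × Coord d)) :=
    ((hasFDerivAt_id p).add_const _).hasMFDerivAt
  have h3 := ((hm.diffeo (p + (0, latticePoint z)) ⟨by simpa using hp, mem_univ _⟩).mdifferentiableAt
    (by simp)).hasMFDerivAt
  rw [← modelDeriv_congr h1]
  exact (h3.comp p h2).mfderiv.symm

/-- `Ψ` is invariant under the deck translations by `ℤ^d`, so everything pulled back by it is too.
-/
theorem IsLocalModel.mixedForm_add (hm : IsLocalModel π D h Ψ)
    {x : Coord d} (hx : x ∈ D) (θ : Coord d) (z : Fin d → ℤ) :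
    mixedForm σ Ψ (x, θ + latticePoint z) = mixedForm σ Ψ (x, θ) := by
  have h1 := hm.modelDeriv_add (p := (x, θ)) hx z
  have h2 : Ψ (x, θ + latticePoint z) = Ψ (x, θ) :=
    ((hm.fibre x hx _ _).2 ⟨z, rfl⟩).symm
  rw [Prod.mk_add_mk, add_zero] at h1
  ext w u
  rw [mixedForm_apply, mixedForm_apply, SymplecticForm.pullback_apply,
    SymplecticForm.pullback_apply, h1, h2]

/-- The composition of a function with the projection, in a local model. -/
theorem IsLocalModel.hasMFDerivAt_proj (hm : IsLocalModel π D h Ψ)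
    {p : Coord d × Coord d} (hp : p.1 ∈ D) :
    HasMFDerivAt 𝓘(ℝ, Coord d × Coord d) 𝓘(ℝ, Coord d) (π ∘ Ψ) p
      ((modelDeriv (n := d) h p.1).comp (ContinuousLinearMap.fst ℝ (Coord d) (Coord d))) := by
  have h1 : π ∘ Ψ =ᶠ[𝓝 p] h ∘ Prod.fst := by
    filter_upwards [hm.isOpen_prod.mem_nhds (show p ∈ D ×ˢ univ from ⟨hp, mem_univ _⟩)] with q hq
    exact hm.proj q.1 hq.1 q.2
  have h2 : HasMFDerivAt 𝓘(ℝ, Coord d × Coord d) 𝓘(ℝ, Coord d)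
      (Prod.fst : Coord d × Coord d → Coord d) p (ContinuousLinearMap.fst ℝ (Coord d) (Coord d)) :=
    hasFDerivAt_fst.hasMFDerivAt
  have h3 := ((hm.base p.1 hp).mdifferentiableAt (by simp)).hasMFDerivAt
  exact (h3.comp p h2).congr_of_eventuallyEq h1

/-- Since `π ∘ Ψ` depends on the base coordinate only, vertical vectors are sent into `ker dπ`,
where the Lagrangian condition applies. -/
theorem IsLocalModel.pullback_vertical [IsManifold 𝓘(ℝ, Coord d) ∞ B] (hm : IsLocalModel π D h Ψ)
    (hπ : IsLagrangianTorusFibration σ π) {p : Coord d × Coord d} (hp : p.1 ∈ D) (v w : Coord d) :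
    σ.pullback Ψ p ![(0, v), (0, w)] = 0 := by
  have hv : ∀ v : Coord d, mfderiv 𝓘(ℝ, Coord (2 * d)) 𝓘(ℝ, Coord d) π (Ψ p)
      (modelDeriv (n := 2 * d) Ψ p (0, v)) = 0 := fun v => by
    have h1 := ((hπ.1.1.mdifferentiable (by simp)) (Ψ p)).hasMFDerivAt
    have h2 := ((hm.diffeo p ⟨hp, mem_univ _⟩).mdifferentiableAt (by simp)).hasMFDerivAt
    have h3 := hasMFDerivAt_unique (h1.comp p h2) (hm.hasMFDerivAt_proj hp)
    have h4 := DFunLike.congr_fun h3 (0, v)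
    refine h4.trans ?_
    change modelDeriv h p.1 0 = 0
    exact map_zero _
  exact (σ.pullback_apply Ψ p _ _).trans (hπ.2 (Ψ p) _ _ (hv v) (hv w))

theorem IsLocalModel.contDiffOn_mixedForm [IsManifold 𝓘(ℝ, Coord (2 * d)) ∞ M] (hm : IsLocalModel π D h Ψ) :
    ContDiffOn ℝ ∞ (mixedForm σ Ψ) (D ×ˢ univ) := by
  refine contDiffOn_clm_apply.2 fun w => contDiffOn_clm_apply.2 fun u => fun p hp => ?_
  have h1 := (σ.pullback_of_isLocalDiffeomorphAt hm.isOpen_prod hm.diffeo hp).1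
  exact ((ContinuousAlternatingMap.apply ℝ _ ℝ
    ![((0 : Coord d), w), (u, (0 : Coord d))]).contDiff.contDiffAt.comp p h1).contDiffWithinAt

theorem IsLocalModel.pullback_vertical_apply (hm : IsLocalModel π D h Ψ)
    [IsManifold 𝓘(ℝ, Coord d) ∞ B] (hπ : IsLagrangianTorusFibration σ π) {p : Coord d × Coord d} (hp : p.1 ∈ D) (w : Coord d)
    (v : Coord d × Coord d) : σ.pullback Ψ p ![(0, w), v] = mixedForm σ Ψ p w v.1 := by
  have h1 : v = (v.1, 0) + (0, v.2) := by simp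
  conv_lhs => rw [h1, ← alternatingBilin_apply, map_add]
  rw [alternatingBilin_apply, alternatingBilin_apply, hm.pullback_vertical hπ hp, add_zero,
    mixedForm_apply]

/-- A vertical vector is already orthogonal to all vertical ones; if its mixed form vanishes it is
orthogonal to everything, and nondegeneracy applies. -/
theorem IsLocalModel.mixedForm_injective (hm : IsLocalModel π D h Ψ)
    [IsManifold 𝓘(ℝ, Coord d) ∞ B] (hπ : IsLagrangianTorusFibration σ π) {p : Coord d × Coord d} (hp : p.1 ∈ D) :
    Function.Injective (mixedForm σ Ψ p) := by
  rw [injective_iff_map_eq_zero]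
  intro w hw
  have h1 : modelDeriv (n := 2 * d) Ψ p (0, w) = 0 := by
    refine σ.nondegenerate (Ψ p) _ fun v => ?_
    obtain ⟨v, rfl⟩ := (hm.bijective_modelDeriv hp).2 v
    refine (σ.pullback_apply Ψ p _ _).symm.trans ?_
    rw [hm.pullback_vertical_apply hπ hp, hw]
    rfl
  have h2 := (hm.bijective_modelDeriv hp).1 (h1.trans (map_zero _).symm)
  exact congrArg Prod.snd h2

theorem IsLocalModel.diff_comp_proj (hm : IsLocalModel π D h Ψ)
    {p : Coord d × Coord d} (hp : p.1 ∈ D) (hπs : MDifferentiable 𝓘(ℝ, Coord (2 * d)) 𝓘(ℝ, Coord d) π)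
    {f : B → ℝ} (hf : MDifferentiable 𝓘(ℝ, Coord d) 𝓘(ℝ, ℝ) f) (v : Coord d × Coord d) :
    diff (f ∘ π) (Ψ p) (modelDeriv (n := 2 * d) Ψ p v) = fderiv ℝ (f ∘ h) p.1 v.1 := by
  have h1 := (hf (π (Ψ p))).hasMFDerivAt.comp (Ψ p) (hπs (Ψ p)).hasMFDerivAt
  have h2 := ((hm.diffeo p ⟨hp, mem_univ _⟩).mdifferentiableAt (by simp)).hasMFDerivAt
  have h3 := h1.comp p h2
  have hfh : MDifferentiableAt 𝓘(ℝ, Coord d) 𝓘(ℝ, ℝ) (f ∘ h) p.1 :=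
    (hf (h p.1)).comp p.1 ((hm.base p.1 hp).mdifferentiableAt (by simp))
  have h4 : HasFDerivAt ((f ∘ h) ∘ Prod.fst)
      ((fderiv ℝ (f ∘ h) p.1).comp (ContinuousLinearMap.fst ℝ (Coord d) (Coord d))) p :=
    hfh.differentiableAt.hasFDerivAt.comp p hasFDerivAt_fst
  have h5 : f ∘ π ∘ Ψ =ᶠ[𝓝 p] (f ∘ h) ∘ Prod.fst := by
    filter_upwards [hm.isOpen_prod.mem_nhds (show p ∈ D ×ˢ univ from ⟨hp, mem_univ _⟩)] with q hq
    exact congrArg f (hm.proj q.1 hq.1 q.2)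
  have h6 := hasMFDerivAt_unique h3 (h4.hasMFDerivAt.congr_of_eventuallyEq h5)
  rw [diff, h1.mfderiv]
  exact DFunLike.congr_fun h6 v

/-- Since `d(f ∘ π)` sees only the base component of a vector, as does the contraction of the form
with a vertical vector, matching the two on the base determines the Hamiltonian field. -/
theorem IsLocalModel.hamVF_eq (hm : IsLocalModel π D h Ψ)
    [IsManifold 𝓘(ℝ, Coord d) ∞ B] (hπ : IsLagrangianTorusFibration σ π) {p : Coord d × Coord d} (hp : p.1 ∈ D)
    {f : B → ℝ} (hf : MDifferentiable 𝓘(ℝ, Coord d) 𝓘(ℝ, ℝ) f) {w : Coord d}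
    (hw : mixedForm σ Ψ p w = fderiv ℝ (f ∘ h) p.1) :
    σ.hamVF (f ∘ π) (Ψ p) = modelDeriv (n := 2 * d) Ψ p (0, w) := by
  refine σ.flat_injective (Ψ p) (LinearMap.ext fun v => ?_)
  obtain ⟨v, rfl⟩ := (hm.bijective_modelDeriv hp).2 v
  refine (σ.form_hamVF (f ∘ π) (Ψ p) _).trans ?_
  refine (hm.diff_comp_proj hp (hπ.1.1.mdifferentiable (by simp)) hf v).trans ?_
  rw [← hw, ← hm.pullback_vertical_apply hπ hp]
  exact σ.pullback_apply Ψ p _ _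

theorem IsLocalModel.hasFDerivAt_mixedForm [IsManifold 𝓘(ℝ, Coord (2 * d)) ∞ M]
    (hm : IsLocalModel π D h Ψ) {x : Coord d} (hx : x ∈ D) (θ w u : Coord d) :
    HasFDerivAt (fun θ => mixedForm σ Ψ (x, θ) w u)
      ((fderiv ℝ (fun q => σ.pullback Ψ q ![(0, w), (u, 0)]) (x, θ)).comp
        (ContinuousLinearMap.inr ℝ (Coord d) (Coord d))) θ := by
  have h1 := (σ.pullback_of_isLocalDiffeomorphAt hm.isOpen_prod hm.diffeo
    (p := (x, θ)) ⟨hx, mem_univ _⟩).1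
  have h2 : DifferentiableAt ℝ (fun q => σ.pullback Ψ q ![(0, w), (u, 0)]) (x, θ) :=
    ((ContinuousAlternatingMap.apply ℝ _ ℝ
      ![((0 : Coord d), w), (u, (0 : Coord d))]).contDiff.contDiffAt.comp
        (x, θ) h1).differentiableAt (by simp)
  exact h2.hasFDerivAt.comp θ (hasFDerivAt_prodMk_right x θ)

theorem IsLocalModel.contDiff_mixedForm_slice [IsManifold 𝓘(ℝ, Coord (2 * d)) ∞ M]
    (hm : IsLocalModel π D h Ψ) {x : Coord d} (hx : x ∈ D) :
    ContDiff ℝ ∞ fun θ => mixedForm σ Ψ (x, θ) := by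
  rw [← contDiffOn_univ]
  exact hm.contDiffOn_mixedForm.comp (contDiff_prodMk_right x).contDiffOn
    fun θ _ => ⟨hx, mem_univ _⟩

/-- Evaluate `d(Ψ*σ) = 0` on one horizontal and two vertical vectors: the term differentiating the
vertical-vertical entry vanishes, and the other two express the required symmetry. -/
theorem IsLocalModel.mixedForm_closed [IsManifold 𝓘(ℝ, Coord (2 * d)) ∞ M]
    (hm : IsLocalModel π D h Ψ)
    [IsManifold 𝓘(ℝ, Coord d) ∞ B] (hπ : IsLagrangianTorusFibration σ π) {x : Coord d} (hx : x ∈ D) (θ v w : Coord d) :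
    fderiv ℝ (fun θ => mixedForm σ Ψ (x, θ)) θ v w =
      fderiv ℝ (fun θ => mixedForm σ Ψ (x, θ)) θ w v := by
  have hslice : ∀ v w u : Coord d, fderiv ℝ (fun θ => mixedForm σ Ψ (x, θ)) θ v w u =
      fderiv ℝ (fun q => σ.pullback Ψ q ![(0, w), (u, 0)]) (x, θ) (0, v) := fun v w u => by
    have h1 := ((hm.contDiff_mixedForm_slice (σ := σ) hx).differentiable (by simp)
      θ).hasFDerivAt
    have h2 : HasFDerivAt (fun θ => mixedForm σ Ψ (x, θ) w u) _ θ :=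
      (h1.clm_apply (hasFDerivAt_const w θ)).clm_apply (hasFDerivAt_const u θ)
    have h3 := DFunLike.congr_fun (h2.unique (hm.hasFDerivAt_mixedForm hx θ w u)) v
    simpa using h3
  ext u
  rw [hslice, hslice]
  obtain ⟨h1, h2⟩ := σ.pullback_of_isLocalDiffeomorphAt hm.isOpen_prod hm.diffeo
    (p := (x, θ)) ⟨hx, mem_univ _⟩
  have h3 := extDeriv_two_apply (h1.differentiableAt (by simp)) (u, 0) (0, v) (0, w)
  have h4 : (fun q => σ.pullback Ψ q ![(0, v), (0, w)]) =ᶠ[𝓝 (x, θ)] fun _ => (0 : ℝ) := by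
    filter_upwards [hm.isOpen_prod.mem_nhds (show (x, θ) ∈ D ×ˢ univ from ⟨hx, mem_univ _⟩)]
      with q hq using hm.pullback_vertical hπ hq.1 v w
  have h5 : ∀ w : Coord d, (fun q => σ.pullback Ψ q ![(u, 0), (0, w)]) =
      fun q => -σ.pullback Ψ q ![(0, w), (u, 0)] := fun w =>
    funext fun q => alternating_swap _ _ _
  rw [h2, h4.fderiv_eq, h5, h5, fderiv_fun_neg, fderiv_fun_neg] at h3
  simp at h3
  linarith

end LocalModel

/-! ### Local models from charts and trivializations -/

section LocalModelExistence

variable {d : ℕ} {M : Type*} [TopologicalSpace M] [ChartedSpace (Coord (2 * d)) M]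
  {B : Type*} [TopologicalSpace B] [ChartedSpace (Coord d) B] [IsManifold 𝓘(ℝ, Coord d) ∞ B]
  {π : M → B}

theorem isLocalDiffeomorphAt_chart_symm (b : B) {x : Coord d}
    (hx : x ∈ (chartAt (Coord d) b).target) :
    IsLocalDiffeomorphAt 𝓘(ℝ, Coord d) 𝓘(ℝ, Coord d) ∞ (chartAt (Coord d) b).symm x :=
  ⟨{ toPartialEquiv := (chartAt (Coord d) b).symm.toPartialEquiv
     open_source := (chartAt (Coord d) b).open_target
     open_target := (chartAt (Coord d) b).open_source
     contMDiffOn_toFun := contMDiffOn_chart_symm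
     contMDiffOn_invFun := contMDiffOn_chart }, hx, fun _ _ => rfl⟩

theorem isLocalDiffeomorphAt_chart_symm_prod (b : B) {x : Coord d}
    (hx : x ∈ (chartAt (Coord d) b).target) (θ : Coord d) :
    IsLocalDiffeomorphAt 𝓘(ℝ, Coord d × Coord d) (𝓘(ℝ, Coord d).prod 𝓘(ℝ, Coord d)) ∞
      (fun p : Coord d × Coord d => ((chartAt (Coord d) b).symm p.1, p.2)) (x, θ) := by
  let e := chartAt (Coord d) b
  exact ⟨{ toPartialEquiv := (e.symm.prod (OpenPartialHomeomorph.refl (Coord d))).toPartialEquiv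
           open_source := (e.symm.prod (OpenPartialHomeomorph.refl (Coord d))).open_source
           open_target := (e.symm.prod (OpenPartialHomeomorph.refl (Coord d))).open_target
           contMDiffOn_toFun := (contMDiffOn_chart_symm.comp contDiff_fst.contMDiff.contMDiffOn
             fun q hq => hq.1).prodMk contDiff_snd.contMDiff.contMDiffOn
           contMDiffOn_invFun := (contMDiffOn_chart.comp contMDiff_fst.contMDiffOn
             fun q hq => hq.1).prodMk_space contMDiff_snd.contMDiffOn },
    ⟨hx, mem_univ _⟩, fun _ _ => rfl⟩

theorem IsTorusFibration.exists_localModel (hπ : IsTorusFibration (d := d) π) (b : B) :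
    ∃ (D : Set (Coord d)) (Ψ : Coord d × Coord d → M),
      IsLocalModel π D (chartAt (Coord d) b).symm Ψ ∧ D ⊆ (chartAt (Coord d) b).target ∧
      chartAt (Coord d) b b ∈ D := by
  obtain ⟨O, hO, hbO, ψ, hψ, hproj, hsurj, hfib⟩ := hπ.2 b
  set e := chartAt (Coord d) b with he
  refine ⟨e.target ∩ e.symm ⁻¹' O, fun p => ψ (e.symm p.1, p.2), ⟨?_, ?_, ?_, ?_, ?_, ?_⟩,
    inter_subset_left, ?_⟩
  · exact e.isOpen_inter_preimage_symm hO
  · intro p hp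
    exact (isLocalDiffeomorphAt_chart_symm_prod b hp.1.1 p.2).comp 𝓘(ℝ, Coord (2 * d)) M
      (hψ ⟨(e.symm p.1, p.2), hp.1.2, mem_univ _⟩)
  · exact fun x hx => isLocalDiffeomorphAt_chart_symm b hx.1
  · exact fun x hx θ => hproj _ hx.2 θ
  · intro x hx m hm
    obtain ⟨θ, hθ⟩ := hsurj m (by rw [hm]; exact hx.2)
    exact ⟨θ, by rw [hm] at hθ; exact hθ⟩
  · intro x hx θ θ'
    rw [hfib _ hx.2]
    refine exists_congr fun z => ⟨fun h => ?_, fun h i => ?_⟩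
    · ext i
      simpa [latticePoint] using h i
    · rw [h]
      simp [latticePoint]
  · exact ⟨mem_chart_target _ b, by simpa [he] using hbO⟩

end LocalModelExistence

/-! ### Linear coordinates on a fibre -/

section TorusChart

variable {d : ℕ} {M : Type*} [TopologicalSpace M] [ChartedSpace (Coord (2 * d)) M]
  {B : Type*} [TopologicalSpace B] [ChartedSpace (Coord d) B]

/-- A uniformization `χ : ℝ^d → π⁻¹(b)` of a fibre, which conjugates the flow of `X_{f ∘ π}` to
the linear flow whose frequency is given by the coefficients of `df_b` in the frame `p`. -/
structure IsTorusChart (σ : SymplecticForm (2 * d) M) (π : M → B) (b : B)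
    (p : Fin d → (TangentSpace 𝓘(ℝ, Coord d) b →L[ℝ] ℝ)) (χ : Coord d → M) : Prop where
  linearIndependent : LinearIndependent ℝ p
  continuous : Continuous χ
  range_eq : range χ = π ⁻¹' {b}
  eq_iff : ∀ u u', χ u = χ u' ↔ ∃ z, u' = u + latticePoint z
  integralCurve : ∀ f : B → ℝ, MDifferentiable 𝓘(ℝ, Coord d) 𝓘(ℝ, ℝ) f → ∀ ν : Coord d,
    diff f b = ∑ j, ν j • p j → ∀ u : Coord d,
      IsMIntegralCurve (I := 𝓘(ℝ, Coord (2 * d))) (fun t : ℝ => χ (u + t • ν)) (σ.hamVF (f ∘ π))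

variable {π : M → B} {σ : SymplecticForm (2 * d) M}
  {D : Set (Coord d)} {h : Coord d → B} {Ψ : Coord d × Coord d → M}

/-- The periods of the mixed form. -/
noncomputable def period (σ : SymplecticForm (2 * d) M) (Ψ : Coord d × Coord d → M)
    (x : Coord d) (j : Fin d) : Coord d →L[ℝ] ℝ :=
  ∫ t in (0 : ℝ)..1, mixedForm σ Ψ (x, t • EuclideanSpace.single j 1) (EuclideanSpace.single j 1)

/-- The pullback of covectors by the derivative of `h`. -/
noncomputable def pullCovector (h : Coord d → B) (x : Coord d) :
    (TangentSpace 𝓘(ℝ, Coord d) (h x) →L[ℝ] ℝ) →ₗ[ℝ] (Coord d →L[ℝ] ℝ) where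
  toFun α := α.comp (mfderiv 𝓘(ℝ, Coord d) 𝓘(ℝ, Coord d) h x)
  map_add' _ _ := rfl
  map_smul' _ _ := rfl

theorem fderiv_comp_eq_pullCovector {x : Coord d} {f : B → ℝ}
    (hf : MDifferentiableAt 𝓘(ℝ, Coord d) 𝓘(ℝ, ℝ) f (h x))
    (hh : MDifferentiableAt 𝓘(ℝ, Coord d) 𝓘(ℝ, Coord d) h x) :
    fderiv ℝ (f ∘ h) x = pullCovector h x (diff f (h x)) :=
  HasFDerivAt.fderiv (HasMFDerivAt.hasFDerivAt (hf.hasMFDerivAt.comp x hh.hasMFDerivAt))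

theorem finrank_dual_coord : Module.finrank ℝ (Coord d →L[ℝ] ℝ) = d := by
  rw [← (LinearMap.toContinuousLinearMap (𝕜 := ℝ) (E := Coord d) (F' := ℝ)).finrank_eq,
    Module.finrank_linearMap]
  simp

theorem IsLocalModel.exists_developing [IsManifold 𝓘(ℝ, Coord (2 * d)) ∞ M]
    (hm : IsLocalModel π D h Ψ) [IsManifold 𝓘(ℝ, Coord d) ∞ B]
    (hπ : IsLagrangianTorusFibration σ π) {x : Coord d} (hx : x ∈ D) :
    LinearIndependent ℝ (period σ Ψ x) ∧ ∃ (S : Coord d → (Coord d →L[ℝ] ℝ))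
      (T : (Coord d →L[ℝ] ℝ) → Coord d),
      (∀ θ, T (S θ) = θ) ∧ (∀ s, S (T s) = s) ∧
      (∀ θ z, S (θ + latticePoint z) = S θ + periodMap (period σ Ψ x) (latticePoint z)) ∧
      ∀ s, ∃ A : Coord d ≃L[ℝ] (Coord d →L[ℝ] ℝ),
        (A : Coord d →L[ℝ] (Coord d →L[ℝ] ℝ)) = mixedForm σ Ψ (x, T s) ∧
        HasFDerivAt T (A.symm : (Coord d →L[ℝ] ℝ) →L[ℝ] Coord d) s :=
  TorusFibration.exists_developing finrank_dual_coord
    ((hm.contDiff_mixedForm_slice hx).of_le (by simp)) (hm.mixedForm_add hx)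
    (fun _ => hm.mixedForm_injective hπ hx) (hm.mixedForm_closed hπ hx) fun _ => rfl

/-- In the coordinate `s = S θ` the field `X_{f ∘ π}` is the constant covector `d(f ∘ h)`, because
the derivative of `T` inverts the mixed form. Expressing `s` in the basis of periods turns the
period lattice into `ℤ^d`, whence `χ u = Ψ (x, T (periodMap u))`. -/
theorem IsLocalModel.exists_torusChart [IsManifold 𝓘(ℝ, Coord (2 * d)) ∞ M]
    (hm : IsLocalModel π D h Ψ) [IsManifold 𝓘(ℝ, Coord d) ∞ B]
    (hπ : IsLagrangianTorusFibration σ π) {x : Coord d} (hx : x ∈ D)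
    {p : Fin d → (TangentSpace 𝓘(ℝ, Coord d) (h x) →L[ℝ] ℝ)}
    (hp : ∀ j, pullCovector h x (p j) = period σ Ψ x j) :
    ∃ χ, IsTorusChart σ π (h x) p χ := by
  obtain ⟨hli, S, T, hTS, hST, hq, hT⟩ := hm.exists_developing hπ hx
  have hTc : Continuous T := continuous_iff_continuousAt.2 fun s => by
    obtain ⟨A, -, hA⟩ := hT s
    exact hA.continuousAt
  have hPi : Function.Injective (periodMap (period σ Ψ x)) := by
    rw [injective_iff_map_eq_zero]
    intro u hu
    rw [periodMap_apply] at hu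
    ext j
    exact Fintype.linearIndependent_iff.1 hli _ hu j
  have hPs : Function.Surjective (periodMap (period σ Ψ x)) :=
    (LinearMap.injective_iff_surjective_of_finrank_eq_finrank
      (f := (periodMap (period σ Ψ x)).toLinearMap) (by simp [finrank_dual_coord])).1 hPi
  refine ⟨fun u => Ψ (x, T (periodMap (period σ Ψ x) u)), ?_, ?_, ?_, ?_, ?_⟩
  · refine LinearIndependent.of_comp (pullCovector h x) ?_
    convert hli
    exact funext hp
  · refine continuous_iff_continuousAt.2 fun u => ?_
    have h1 := (hm.diffeo (x, T (periodMap (period σ Ψ x) u))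
      ⟨hx, mem_univ _⟩).contMDiffAt.continuousAt
    exact ContinuousAt.comp (f := fun u => (x, T (periodMap (period σ Ψ x) u))) h1
      (continuous_const.prodMk (hTc.comp (periodMap (period σ Ψ x)).continuous)).continuousAt
  · ext m
    constructor
    · rintro ⟨u, rfl⟩
      exact hm.proj x hx _
    · intro hmem
      obtain ⟨θ, rfl⟩ := hm.surj x hx m hmem
      obtain ⟨u, hu⟩ := hPs (S θ)
      exact ⟨u, by simp only [hu, hTS]⟩
  · intro u u'
    rw [hm.fibre x hx]
    refine exists_congr fun z => ⟨fun h1 => hPi ?_, fun h1 => ?_⟩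
    · have := congrArg S h1
      rwa [hq, hST, hST, ← map_add] at this
    · rw [h1, map_add]
      have := hq (T (periodMap (period σ Ψ x) u)) z
      rw [hST] at this
      rw [← this, hTS]
  · intro f hf ν hν u t
    obtain ⟨A, hA, hAT⟩ := hT (periodMap (period σ Ψ x) (u + t • ν))
    set θ := T (periodMap (period σ Ψ x) (u + t • ν)) with hθ
    -- The vector `A.symm (periodMap ν)` is the velocity in `θ` of the curve; this identity says
    -- that it satisfies the defining equation of the Hamiltonian field.
    have hw : mixedForm σ Ψ (x, θ) (A.symm (periodMap (period σ Ψ x) ν)) =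
        fderiv ℝ (f ∘ h) x := by
      rw [← hA]
      refine (A.apply_symm_apply _).trans ?_
      rw [fderiv_comp_eq_pullCovector (hf (h x)) ((hm.base x hx).mdifferentiableAt (by simp)), hν,
        map_sum, periodMap_apply]
      exact Finset.sum_congr rfl fun j _ => by rw [map_smul, hp]
    have h3 : HasDerivAt (fun t : ℝ => (x, T (periodMap (period σ Ψ x) (u + t • ν))))
        ((0 : Coord d), A.symm (periodMap (period σ Ψ x) ν)) t := by
      have h4 : HasDerivAt (fun t : ℝ => periodMap (period σ Ψ x) (u + t • ν))
          (periodMap (period σ Ψ x) ν) t := by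
        have h5 : HasDerivAt (fun t : ℝ => u + t • ν) ((1 : ℝ) • ν) t :=
          ((hasDerivAt_id t).smul_const ν).const_add u
        rw [one_smul] at h5
        exact (periodMap (period σ Ψ x)).hasFDerivAt.comp_hasDerivAt t h5
      have h6 : HasDerivAt (fun t : ℝ => T (periodMap (period σ Ψ x) (u + t • ν)))
          (A.symm (periodMap (period σ Ψ x) ν)) t := by
        have h7 := HasFDerivAt.comp_hasDerivAt t hAT h4
        exact h7
      exact (hasDerivAt_const t x).prodMk h6
    have h6 := ((hm.diffeo (x, θ) ⟨hx, mem_univ _⟩).mdifferentiableAt (by simp)).hasMFDerivAt.comp t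
      h3.hasFDerivAt.hasMFDerivAt
    refine h6.congr_mfderiv (ContinuousLinearMap.ext_ring ?_)
    change modelDeriv (n := 2 * d) Ψ (x, θ)
      ((1 : ℝ) • ((0 : Coord d), A.symm (periodMap (period σ Ψ x) ν))) =
        (1 : ℝ) • σ.hamVF (f ∘ π) (Ψ (x, θ))
    rw [one_smul, one_smul]
    exact (hm.hamVF_eq hπ (p := (x, θ)) hx hf hw).symm

end TorusChart

/-! ### Smooth frames of the resonance bundle and smoothness of Hamiltonian fields -/

section Frames

variable {d : ℕ} {M : Type*} [TopologicalSpace M] [ChartedSpace (Coord (2 * d)) M]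
  {B : Type*} [TopologicalSpace B] [ChartedSpace (Coord d) B]
  {π : M → B} {σ : SymplecticForm (2 * d) M}
  {D : Set (Coord d)} {h : Coord d → B} {Ψ : Coord d × Coord d → M}

theorem isInvertible_of_injective {E G : Type*} [NormedAddCommGroup E] [NormedSpace ℝ E]
    [NormedAddCommGroup G] [NormedSpace ℝ G] [FiniteDimensional ℝ E] [FiniteDimensional ℝ G]
    (hEG : Module.finrank ℝ E = Module.finrank ℝ G) {A : E →L[ℝ] G} (hA : Function.Injective A) :
    A.IsInvertible :=
  ⟨(LinearEquiv.ofInjectiveOfFinrankEq A.toLinearMap hA hEG).toContinuousLinearEquiv, by ext; rfl⟩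

section IsInvertible

variable {E G : Type*} [TopologicalSpace E] [AddCommGroup E] [Module ℝ E]
  [TopologicalSpace G] [AddCommGroup G] [Module ℝ G] {A : E →L[ℝ] G}

theorem apply_inverse_of_isInvertible (hA : A.IsInvertible) (v : G) : A (A.inverse v) = v := by
  obtain ⟨A', rfl⟩ := hA
  simp

theorem inverse_apply_of_isInvertible (hA : A.IsInvertible) (v : E) : A.inverse (A v) = v := by
  obtain ⟨A', rfl⟩ := hA
  simp

end IsInvertible

theorem IsLocalModel.contDiffOn_period [IsManifold 𝓘(ℝ, Coord (2 * d)) ∞ M]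
    (hm : IsLocalModel π D h Ψ) (j : Fin d) : ContDiffOn ℝ ∞ (fun x => period σ Ψ x j) D := by
  refine contDiffOn_intervalIntegral hm.isOpen (g := fun q : Coord d × ℝ =>
    mixedForm σ Ψ (q.1, q.2 • EuclideanSpace.single j 1) (EuclideanSpace.single j 1)) ?_
  refine ContDiffOn.clm_apply ?_ contDiffOn_const
  refine hm.contDiffOn_mixedForm.comp (ContDiff.contDiffOn ?_) fun q hq => ⟨hq.1, mem_univ _⟩
  exact contDiff_fst.prodMk (contDiff_snd.smul contDiff_const)

/-- The linear map whose components are the periods. -/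
noncomputable def periodComponents (σ : SymplecticForm (2 * d) M) (Ψ : Coord d × Coord d → M)
    (x : Coord d) : Coord d →L[ℝ] Coord d :=
  ∑ i, (period σ Ψ x i).smulRight (EuclideanSpace.single i (1 : ℝ))

theorem periodComponents_apply (x u : Coord d) (i : Fin d) :
    periodComponents σ Ψ x u i = period σ Ψ x i u := by
  simp [periodComponents, Pi.single_apply]

/-- The frame of vector fields dual to the periods. -/
noncomputable def dualField (σ : SymplecticForm (2 * d) M) (Ψ : Coord d × Coord d → M)
    (j : Fin d) (x : Coord d) : Coord d :=
  (periodComponents σ Ψ x).inverse (EuclideanSpace.single j 1)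

variable [IsManifold 𝓘(ℝ, Coord (2 * d)) ∞ M] [IsManifold 𝓘(ℝ, Coord d) ∞ B]

theorem IsLocalModel.isInvertible_periodComponents (hm : IsLocalModel π D h Ψ)
    (hπ : IsLagrangianTorusFibration σ π) {x : Coord d} (hx : x ∈ D) :
    (periodComponents σ Ψ x).IsInvertible := by
  refine isInvertible_of_injective rfl ?_
  rw [injective_iff_map_eq_zero]
  intro u hu
  obtain ⟨hli, -⟩ := hm.exists_developing hπ hx
  have hspan := hli.span_eq_top_of_card_eq_finrank' (by simp [finrank_dual_coord])
  let ev : (Coord d →L[ℝ] ℝ) →ₗ[ℝ] ℝ := (ContinuousLinearMap.apply ℝ ℝ u).toLinearMap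
  have hev : ev = 0 := by
    refine LinearMap.ext_on_range hspan fun i => ?_
    change period σ Ψ x i u = 0
    rw [← periodComponents_apply, hu]
    rfl
  -- The periods span the dual, so `u` is killed by every covector, in particular by the inner
  -- product with itself.
  have h1 := LinearMap.congr_fun hev (innerSL ℝ u)
  exact inner_self_eq_zero.1 h1

theorem IsLocalModel.period_dualField (hm : IsLocalModel π D h Ψ)
    (hπ : IsLagrangianTorusFibration σ π) {x : Coord d} (hx : x ∈ D) (i j : Fin d) :
    period σ Ψ x i (dualField σ Ψ j x) = if i = j then 1 else 0 := by
  rw [← periodComponents_apply, dualField]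
  rw [apply_inverse_of_isInvertible (hm.isInvertible_periodComponents hπ hx)]
  simp

theorem IsLocalModel.contDiffOn_dualField (hm : IsLocalModel π D h Ψ)
    (hπ : IsLagrangianTorusFibration σ π) (j : Fin d) : ContDiffOn ℝ ∞ (dualField σ Ψ j) D := by
  intro x hx
  have h1 : ContDiffAt ℝ ∞ (periodComponents σ Ψ) x := by
    refine ContDiffOn.contDiffAt (s := D) ?_ (hm.isOpen.mem_nhds hx)
    unfold periodComponents
    exact ContDiffOn.sum fun i _ => contDiffOn_clm_apply.2 fun u =>
      ((hm.contDiffOn_period i).clm_apply contDiffOn_const).smul contDiffOn_const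
  have h2 := (hm.isInvertible_periodComponents hπ hx).contDiffAt_map_inverse (n := ∞)
  exact ((h2.comp x h1).clm_apply contDiffAt_const).contDiffWithinAt

/-- Near every point of the base there is a smooth frame which is dual to the lattice of the
fibres. -/
theorem exists_localFrame (hπ : IsLagrangianTorusFibration σ π) (b₀ : B) :
    ∃ O : Set B, IsOpen O ∧ b₀ ∈ O ∧ ∃ K : Fin d → ∀ b : B, TangentSpace 𝓘(ℝ, Coord d) b,
      (∀ j, ContMDiffOn 𝓘(ℝ, Coord d) 𝓘(ℝ, Coord d).tangent ∞
        (fun b => (⟨b, K j b⟩ : TangentBundle 𝓘(ℝ, Coord d) B)) O) ∧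
      ∀ b ∈ O, ∃ p χ, IsTorusChart σ π b p χ ∧ ∀ i j, p i (K j b) = if i = j then 1 else 0 := by
  obtain ⟨D, Ψ, hm, hD, hb⟩ := hπ.1.exists_localModel b₀
  set e := chartAt (Coord d) b₀ with he
  have hdm : e.MDifferentiable 𝓘(ℝ, Coord d) 𝓘(ℝ, Coord d) := mdifferentiable_chart b₀
  have hinv : ∀ b ∈ e.source, (mfderiv 𝓘(ℝ, Coord d) 𝓘(ℝ, Coord d) e b).IsInvertible :=
    fun b hb => ⟨hdm.mfderiv hb, rfl⟩
  refine ⟨e.source ∩ e ⁻¹' D, e.isOpen_inter_preimage hm.isOpen, ⟨mem_chart_source _ _, hb⟩,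
    fun j => VectorField.mpullback 𝓘(ℝ, Coord d) 𝓘(ℝ, Coord d) e (dualField σ Ψ j), ?_, ?_⟩
  · intro j b hb
    have h1 : ContMDiffAt 𝓘(ℝ, Coord d) 𝓘(ℝ, Coord d).tangent ∞
        (fun x => (⟨x, dualField σ Ψ j x⟩ : TangentBundle 𝓘(ℝ, Coord d) (Coord d))) (e b) :=
      contMDiffAt_vectorSpace_iff_contDiffAt.2
        ((hm.contDiffOn_dualField hπ j).contDiffAt (hm.isOpen.mem_nhds hb.2))
    have h2 : ContMDiffAt 𝓘(ℝ, Coord d) 𝓘(ℝ, Coord d) ∞ e b :=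
      contMDiffOn_chart.contMDiffAt (e.open_source.mem_nhds hb.1)
    exact (h1.mpullback_vectorField_preimage h2 (hinv b hb.1) le_rfl).contMDiffWithinAt
  · rintro b ⟨hbs, hbD⟩
    obtain ⟨x, hx, rfl⟩ : ∃ x ∈ D, e.symm x = b := ⟨e b, hbD, e.left_inv hbs⟩
    have hxe : e (e.symm x) = x := e.right_inv (hD hx)
    let A : TangentSpace 𝓘(ℝ, Coord d) (e.symm x) →L[ℝ] Coord d :=
      mfderiv 𝓘(ℝ, Coord d) 𝓘(ℝ, Coord d) e (e.symm x)
    -- The periods are transported by the same derivative of the chart as the dual fields, so the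
    -- pairing is unchanged; `e` being inverse to `h`, their pullbacks by `h` are the periods
    -- themselves.
    let p : Fin d → (TangentSpace 𝓘(ℝ, Coord d) (e.symm x) →L[ℝ] ℝ) :=
      fun i => (period σ Ψ x i).comp A
    obtain ⟨χ, hχ⟩ := hm.exists_torusChart hπ hx (p := p) fun i => by
      ext u
      have := DFunLike.congr_fun (hdm.comp_symm_deriv (hD hx)) u
      exact congrArg (period σ Ψ x i) this
    refine ⟨p, χ, hχ, fun i j => ?_⟩
    rw [← hm.period_dualField hπ hx i j]
    have h1 : A (A.inverse (dualField σ Ψ j (e (e.symm x)))) = dualField σ Ψ j (e (e.symm x)) :=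
      apply_inverse_of_isInvertible (hinv _ hbs) _
    refine congrArg (period σ Ψ x i) (h1.trans ?_)
    rw [hxe]

/-- The Hamiltonian vector field of a function of the base is smooth. -/
theorem contMDiff_hamVF_comp_proj (hπ : IsLagrangianTorusFibration σ π) {f : B → ℝ}
    (hf : ContMDiff 𝓘(ℝ, Coord d) 𝓘(ℝ, ℝ) ∞ f) :
    ContMDiff 𝓘(ℝ, Coord (2 * d)) 𝓘(ℝ, Coord (2 * d)).tangent 1
      (fun m => (⟨m, σ.hamVF (f ∘ π) m⟩ : TangentBundle 𝓘(ℝ, Coord (2 * d)) M)) := by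
  intro m
  obtain ⟨D, Ψ, hm, hD, hb⟩ := hπ.1.exists_localModel (π m)
  set h := (chartAt (Coord d) (π m)).symm with hh
  set x := chartAt (Coord d) (π m) (π m) with hx
  obtain ⟨θ, hθ⟩ := hm.surj x hb m (by simp [hh, hx])
  obtain ⟨Φ, hp, hΦ⟩ := hm.diffeo (x, θ) ⟨hb, mem_univ _⟩
  have hfd : MDifferentiable 𝓘(ℝ, Coord d) 𝓘(ℝ, ℝ) f := hf.mdifferentiable (by simp)
  -- The expression of the Hamiltonian field in the local model, obtained by solving the equation of
  -- `IsLocalModel.hamVF_eq`; it is smooth since inversion of linear maps is.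
  let W : Coord d × Coord d → Coord d × Coord d := fun q =>
    (0, (mixedForm σ Ψ q).inverse (fderiv ℝ (f ∘ h) q.1))
  have hinv : ∀ q : Coord d × Coord d, q.1 ∈ D → (mixedForm σ Ψ q).IsInvertible := fun q hq =>
    isInvertible_of_injective (by simp [finrank_dual_coord]) (hm.mixedForm_injective hπ hq)
  have hW : ContDiffAt ℝ ∞ W (x, θ) := by
    have h1 : ContDiffAt ℝ ∞ (mixedForm σ Ψ) (x, θ) :=
      hm.contDiffOn_mixedForm.contDiffAt (hm.isOpen_prod.mem_nhds ⟨hb, mem_univ _⟩)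
    have h2 := (hinv (x, θ) hb).contDiffAt_map_inverse (n := ∞)
    have h3 : ContDiffAt ℝ ∞ (f ∘ h) x :=
      contMDiffAt_iff_contDiffAt.1 ((hf (h x)).comp x (hm.base x hb).contMDiffAt)
    have h4 : ContDiffAt ℝ ∞ (fun q : Coord d × Coord d => fderiv ℝ (f ∘ h) q.1) (x, θ) :=
      (h3.fderiv_right (m := ∞) (by simp)).comp (x, θ) contDiffAt_fst
    exact contDiffAt_const.prodMk ((h2.comp (x, θ) h1).clm_apply h4)
  let e : OpenPartialHomeomorph M (Coord d × Coord d) := Φ.symm.toOpenPartialHomeomorph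
  have hdm : e.MDifferentiable 𝓘(ℝ, Coord (2 * d)) 𝓘(ℝ, Coord d × Coord d) :=
    ⟨Φ.contMDiffOn_invFun.mdifferentiableOn (by simp),
      Φ.contMDiffOn_toFun.mdifferentiableOn (by simp)⟩
  have hΨe : ∀ q ∈ Φ.source, Ψ q ∈ e.source ∧ e (Ψ q) = q := fun q hq => by
    rw [hΦ hq]
    exact ⟨Φ.map_source hq, Φ.left_inv hq⟩
  have hme : m ∈ e.source := hθ ▸ (hΨe _ hp).1
  have hem : e m = (x, θ) := hθ ▸ (hΨe _ hp).2
  have heq : ∀ q ∈ Φ.source, q.1 ∈ D →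
      VectorField.mpullback 𝓘(ℝ, Coord (2 * d)) 𝓘(ℝ, Coord d × Coord d) e W (Ψ q) =
        σ.hamVF (f ∘ π) (Ψ q) := by
    intro q hq hqD
    have h1 : e ∘ Ψ =ᶠ[𝓝 q] id :=
      Filter.eventuallyEq_of_mem (Φ.open_source.mem_nhds hq) fun q hq => (hΨe q hq).2
    have h2 := ((hm.diffeo q ⟨hqD, mem_univ _⟩).mdifferentiableAt (by simp)).hasMFDerivAt
    have h3 := (hdm.mdifferentiableAt (hΨe q hq).1).hasMFDerivAt.comp q h2
    have h4 := DFunLike.congr_fun (hasMFDerivAt_unique h3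
      ((hasMFDerivAt_id q).congr_of_eventuallyEq h1)) (W q)
    have h6 := inverse_apply_of_isInvertible (A := mfderiv 𝓘(ℝ, Coord (2 * d))
      𝓘(ℝ, Coord d × Coord d) e (Ψ q)) ⟨hdm.mfderiv (hΨe q hq).1, rfl⟩
      (modelDeriv (n := 2 * d) Ψ q (W q))
    have h7 : W (e (Ψ q)) = W q := by rw [(hΨe q hq).2]
    refine (congrArg (fun v => (mfderiv 𝓘(ℝ, Coord (2 * d))
      𝓘(ℝ, Coord d × Coord d) e (Ψ q)).inverse v) h7).trans ?_
    refine Eq.trans ?_ (hm.hamVF_eq hπ (p := q) hqD hfd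
      (apply_inverse_of_isInvertible (hinv q hqD) _)).symm
    refine Eq.trans ?_ h6
    exact congrArg _ h4.symm
  have h1 : ContMDiffAt 𝓘(ℝ, Coord d × Coord d) 𝓘(ℝ, Coord d × Coord d).tangent ∞
      (fun q => (⟨q, W q⟩ : TangentBundle 𝓘(ℝ, Coord d × Coord d) (Coord d × Coord d))) (e m) := by
    rw [hem]
    exact contMDiffAt_vectorSpace_iff_contDiffAt.2 hW
  have h2 : ContMDiffAt 𝓘(ℝ, Coord (2 * d)) 𝓘(ℝ, Coord d × Coord d) ∞ e m :=
    Φ.contMDiffOn_invFun.contMDiffAt (e.open_source.mem_nhds hme)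
  refine ((h1.mpullback_vectorField_preimage h2 ⟨hdm.mfderiv hme, rfl⟩
    le_rfl).of_le (by simp)).congr_of_eventuallyEq ?_
  filter_upwards [(e.isOpen_inter_preimage hm.isOpen_prod).mem_nhds
    (show m ∈ _ from ⟨hme, by rw [mem_preimage, hem]; exact ⟨hb, mem_univ _⟩⟩)] with m' hm'
  have h3 : e m' ∈ Φ.source := e.map_source hm'.1
  have h4 : Ψ (e m') = m' := (hΦ h3).trans (e.left_inv hm'.1)
  have h5 := heq _ h3 hm'.2.1
  rw [h4] at h5
  rw [h5]

end Frames

/-! ### The lattices `E*_b` and `E_b` in a torus chart -/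

section Lattices

variable {d : ℕ} {M : Type*} [TopologicalSpace M] [ChartedSpace (Coord (2 * d)) M]
  {B : Type*} [TopologicalSpace B] [ChartedSpace (Coord d) B]
  {π : M → B} {σ : SymplecticForm (2 * d) M} {b : B}
  {p : Fin d → (TangentSpace 𝓘(ℝ, Coord d) b →L[ℝ] ℝ)} {χ : Coord d → M}

/-- A linear function in a chart, cut off by a bump function: the action lattice is defined by
functions on the whole base. -/
theorem exists_contMDiff_diff_eq [IsManifold 𝓘(ℝ, Coord d) ∞ B] [T2Space B] (b : B)
    (α : TangentSpace 𝓘(ℝ, Coord d) b →L[ℝ] ℝ) :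
    ∃ f : B → ℝ, ContMDiff 𝓘(ℝ, Coord d) 𝓘(ℝ, ℝ) ∞ f ∧ diff f b = α := by
  let A : TangentSpace 𝓘(ℝ, Coord d) b →L[ℝ] Coord d :=
    mfderiv 𝓘(ℝ, Coord d) 𝓘(ℝ, Coord d) (extChartAt 𝓘(ℝ, Coord d) b) b
  have hA : A.IsInvertible := isInvertible_mfderiv_extChartAt (mem_extChartAt_source b)
  let L : Coord d →L[ℝ] ℝ := α.comp A.inverse
  let η : SmoothBumpFunction 𝓘(ℝ, Coord d) b := Classical.arbitrary _
  refine ⟨fun x => η x • L (extChartAt 𝓘(ℝ, Coord d) b x),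
    η.contMDiff_smul (L.contDiff.contMDiff.comp_contMDiffOn contMDiffOn_extChartAt), ?_⟩
  have heq : (fun x => η x • L (extChartAt 𝓘(ℝ, Coord d) b x)) =ᶠ[𝓝 b]
      L ∘ extChartAt 𝓘(ℝ, Coord d) b := by
    filter_upwards [η.eventuallyEq_one] with x hx
    simp [hx]
  have hd : MDifferentiableAt 𝓘(ℝ, Coord d) 𝓘(ℝ, Coord d) (extChartAt 𝓘(ℝ, Coord d) b) b :=
    mdifferentiableAt_extChartAt (mem_chart_source _ b)
  refine heq.mfderiv_eq.trans ?_
  refine (mfderiv_comp b L.differentiableAt.mdifferentiableAt hd).trans ?_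
  rw [mfderiv_eq_fderiv, L.fderiv]
  ext v
  exact congrArg α (inverse_apply_of_isInvertible hA v)

theorem IsTorusChart.span_eq_top (hχ : IsTorusChart σ π b p χ) :
    Submodule.span ℝ (range p) = ⊤ :=
  hχ.linearIndependent.span_eq_top_of_card_eq_finrank'
    ((Fintype.card_fin d).trans (finrank_dual_coord (d := d)).symm)

theorem IsTorusChart.exists_eq_sum (hχ : IsTorusChart σ π b p χ)
    (α : TangentSpace 𝓘(ℝ, Coord d) b →L[ℝ] ℝ) : ∃ ν : Coord d, α = ∑ j, ν j • p j := by
  have hα : α ∈ Submodule.span ℝ (range p) := hχ.span_eq_top ▸ Submodule.mem_top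
  obtain ⟨c, hc⟩ := (Submodule.mem_span_range_iff_exists_fun ℝ).1 hα
  exact ⟨WithLp.toLp 2 c, hc.symm⟩

theorem IsTorusChart.ext_of_apply_eq (hχ : IsTorusChart σ π b p χ)
    {k k' : TangentSpace 𝓘(ℝ, Coord d) b} (h : ∀ j, p j k = p j k') : k = k' := by
  refine PiLp.ext fun i => ?_
  let α : TangentSpace 𝓘(ℝ, Coord d) b →L[ℝ] ℝ := EuclideanSpace.proj (𝕜 := ℝ) i
  change α k = α k'
  obtain ⟨ν, hν⟩ := hχ.exists_eq_sum α
  have hval : ∀ v : TangentSpace 𝓘(ℝ, Coord d) b, α v = ∑ j, ν j * p j v := fun v => by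
    refine (DFunLike.congr_fun hν v).trans ?_
    simp
  refine (hval k).trans (Eq.trans ?_ (hval k').symm)
  simp only [h]

variable [IsManifold 𝓘(ℝ, Coord (2 * d)) ∞ M] [IsManifold 𝓘(ℝ, Coord d) ∞ B] [T2Space M]

/-- The action lattice and the flows refer to arbitrary integral curves; uniqueness identifies these
with the linear curves of a torus chart. -/
theorem IsLagrangianTorusFibration.integralCurve_unique (hπ : IsLagrangianTorusFibration σ π)
    {f : B → ℝ} (hf : ContMDiff 𝓘(ℝ, Coord d) 𝓘(ℝ, ℝ) ∞ f) {γ γ' : ℝ → M}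
    (hγ : IsMIntegralCurve (I := 𝓘(ℝ, Coord (2 * d))) γ (σ.hamVF (f ∘ π)))
    (hγ' : IsMIntegralCurve (I := 𝓘(ℝ, Coord (2 * d))) γ' (σ.hamVF (f ∘ π)))
    (h : γ 0 = γ' 0) : γ = γ' := by
  have : IsManifold 𝓘(ℝ, Coord (2 * d)) 1 M := .of_le (n := ∞) (by simp)
  exact isMIntegralCurve_Ioo_eq_of_contMDiff_boundaryless (contMDiff_hamVF_comp_proj hπ hf)
    hγ hγ' h

theorem IsTorusChart.integralCurve_eq (hπ : IsLagrangianTorusFibration σ π)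
    (hχ : IsTorusChart σ π b p χ) {f : B → ℝ} (hf : ContMDiff 𝓘(ℝ, Coord d) 𝓘(ℝ, ℝ) ∞ f)
    {ν : Coord d} (hν : diff f b = ∑ j, ν j • p j) {γ : ℝ → M}
    (hγ : IsMIntegralCurve (I := 𝓘(ℝ, Coord (2 * d))) γ (σ.hamVF (f ∘ π))) {u : Coord d}
    (hu : χ u = γ 0) (t : ℝ) : γ t = χ (u + t • ν) := by
  have hf' : MDifferentiable 𝓘(ℝ, Coord d) 𝓘(ℝ, ℝ) f := hf.mdifferentiable (by simp)
  exact congrFun (hπ.integralCurve_unique hf hγ (hχ.integralCurve f hf' ν hν u)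
    (by simpa using hu.symm)) t

/-- The curve `χ (u + t • ν)` closes up at time `1` exactly when `ν` is an integer vector. -/
theorem IsTorusChart.mem_actionLattice_iff [T2Space B] (hπ : IsLagrangianTorusFibration σ π)
    (hχ : IsTorusChart σ π b p χ) {α : TangentSpace 𝓘(ℝ, Coord d) b →L[ℝ] ℝ} :
    α ∈ actionLattice σ π b ↔ ∃ z : Fin d → ℤ, α = ∑ j, (z j : ℝ) • p j := by
  constructor
  · rintro ⟨f, hf, hfα, hper⟩
    obtain ⟨ν, hν⟩ := hχ.exists_eq_sum α
    have hc := hχ.integralCurve f (hf.mdifferentiable (by simp)) ν (hfα.trans hν) 0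
    have h0 : π (χ (0 + (0 : ℝ) • ν)) = b := by
      have : χ (0 + (0 : ℝ) • ν) ∈ π ⁻¹' {b} := hχ.range_eq ▸ mem_range_self _
      exact this
    have h1 := hper _ hc h0 0
    obtain ⟨z, hz⟩ := (hχ.eq_iff _ _).1 h1.symm
    refine ⟨z, hν.trans ?_⟩
    have hνz : ν = latticePoint z := by simpa using hz
    refine Finset.sum_congr rfl fun j _ => ?_
    rw [hνz]
    rfl
  · rintro ⟨z, hz⟩
    obtain ⟨f, hf, hfα⟩ := exists_contMDiff_diff_eq b α
    refine ⟨f, hf, hfα, fun γ hγ hγb t => ?_⟩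
    have hmem : γ 0 ∈ range χ := by rw [hχ.range_eq]; exact hγb
    obtain ⟨u, hu⟩ := hmem
    have hν : diff f b = ∑ j, latticePoint z j • p j := hfα.trans hz
    rw [hχ.integralCurve_eq hπ hf hν hγ hu, hχ.integralCurve_eq hπ hf hν hγ hu]
    refine ((hχ.eq_iff _ _).2 ⟨z, ?_⟩).symm
    rw [add_smul, one_smul, add_assoc]

theorem IsTorusChart.mem_resonanceLattice_iff [T2Space B] (hπ : IsLagrangianTorusFibration σ π)
    (hχ : IsTorusChart σ π b p χ) {k : TangentSpace 𝓘(ℝ, Coord d) b} :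
    k ∈ resonanceLattice σ π b ↔ ∃ n : Fin d → ℤ, ∀ j, p j k = n j := by
  constructor
  · intro hk
    refine Classical.skolem.1 fun j => hk (p j) ((hχ.mem_actionLattice_iff hπ).2
      ⟨Pi.single j 1, ?_⟩)
    rw [Finset.sum_eq_single j]
    · simp
    · intro i _ hij
      simp [Pi.single_eq_of_ne hij]
    · simp
  · rintro ⟨n, hn⟩ α hα
    obtain ⟨z, rfl⟩ := (hχ.mem_actionLattice_iff hπ).1 hα
    refine ⟨∑ j, z j * n j, ?_⟩
    simp [hn]

end Lattices

/-! ### Resonant sets and the Baire argument -/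

section Resonances

variable {d : ℕ} {M : Type*} [TopologicalSpace M] [ChartedSpace (Coord (2 * d)) M]
  {B : Type*} [TopologicalSpace B] [ChartedSpace (Coord d) B]
  {π : M → B} {σ : SymplecticForm (2 * d) M} {b : B}
  {p : Fin d → (TangentSpace 𝓘(ℝ, Coord d) b →L[ℝ] ℝ)} {χ : Coord d → M}

/-- Resonant sets are closed only relative to their domain, and their closure may reach its
boundary; but any open set inside the closure meets `U`, and there lies in `U ∩ C`. -/
theorem isNowhereDense_inter_of_isOpen_of_isClosed {X : Type*} [TopologicalSpace X] {U C : Set X}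
    (hU : IsOpen U) (hC : IsClosed C) (h : interior (U ∩ C) = ∅) : IsNowhereDense (U ∩ C) := by
  rw [IsNowhereDense, ← not_nonempty_iff_eq_empty]
  rintro ⟨x, hx⟩
  have hsub : interior (closure (U ∩ C)) ∩ U ⊆ U ∩ C := fun y hy =>
    ⟨hy.2, hC.closure_subset_iff.2 inter_subset_right (interior_subset hy.1)⟩
  obtain ⟨y, hy, hyU⟩ := mem_closure_iff.1 (interior_subset hx) _ isOpen_interior hx
  have : y ∈ interior (U ∩ C) :=
    interior_maximal hsub (isOpen_interior.inter hU) ⟨hy, hyU.1⟩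
  rw [h] at this
  exact this

/-- The combination with integer coefficients of vector fields. -/
noncomputable def intCombination (K : Fin d → ∀ b : B, TangentSpace 𝓘(ℝ, Coord d) b)
    (n : Fin d → ℤ) (b : B) : TangentSpace 𝓘(ℝ, Coord d) b :=
  ∑ j, (n j : ℝ) • K j b

theorem apply_intCombination {K : Fin d → ∀ b : B, TangentSpace 𝓘(ℝ, Coord d) b}
    (hK : ∀ i j, p i (K j b) = if i = j then 1 else 0) (n : Fin d → ℤ) (i : Fin d) :
    p i (intCombination K n b) = n i := by
  simp [intCombination, map_sum, hK]

theorem intCombination_ne_zero {K : Fin d → ∀ b : B, TangentSpace 𝓘(ℝ, Coord d) b}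
    (hK : ∀ i j, p i (K j b) = if i = j then 1 else 0) {n : Fin d → ℤ} (hn : n ≠ 0) :
    intCombination K n b ≠ 0 := fun h0 => hn <| funext fun i => by
  have := apply_intCombination hK n i
  rw [h0, map_zero] at this
  exact_mod_cast this.symm

variable [IsManifold 𝓘(ℝ, Coord d) ∞ B]

theorem contMDiffOn_intCombination {K : Fin d → ∀ b : B, TangentSpace 𝓘(ℝ, Coord d) b} {O : Set B}
    (hK : ∀ j, ContMDiffOn 𝓘(ℝ, Coord d) 𝓘(ℝ, Coord d).tangent ∞
      (fun b => (⟨b, K j b⟩ : TangentBundle 𝓘(ℝ, Coord d) B)) O) (n : Fin d → ℤ) :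
    ContMDiffOn 𝓘(ℝ, Coord d) 𝓘(ℝ, Coord d).tangent ∞
      (fun b => (⟨b, intCombination K n b⟩ : TangentBundle 𝓘(ℝ, Coord d) B)) O :=
  ContMDiffOn.sum_section (V := fun b : B => TangentSpace 𝓘(ℝ, Coord d) b)
    (t := fun j b => (n j : ℝ) • K j b) fun j _ => (hK j).const_smul_section (a := (n j : ℝ))

theorem continuousOn_diff_apply {F : B → ℝ} (hF : ContMDiff 𝓘(ℝ, Coord d) 𝓘(ℝ, ℝ) ∞ F)
    {k : ∀ b : B, TangentSpace 𝓘(ℝ, Coord d) b} {O : Set B}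
    (hk : ContMDiffOn 𝓘(ℝ, Coord d) 𝓘(ℝ, Coord d).tangent ∞
      (fun b => (⟨b, k b⟩ : TangentBundle 𝓘(ℝ, Coord d) B)) O) :
    ContinuousOn (fun b => diff F b (k b)) O := by
  have h1 : Continuous (tangentMap 𝓘(ℝ, Coord d) 𝓘(ℝ, ℝ) F) :=
    hF.continuous_tangentMap (by simp)
  have h2 : Continuous (fun v : TangentBundle 𝓘(ℝ, ℝ) ℝ =>
      (tangentBundleModelSpaceHomeomorph 𝓘(ℝ, ℝ) v).2) :=
    continuous_snd.comp (tangentBundleModelSpaceHomeomorph 𝓘(ℝ, ℝ)).continuous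
  exact (h2.comp h1).comp_continuousOn hk.continuousOn

theorem exists_isClosed_resonantSet_eq {F : B → ℝ} (hF : ContMDiff 𝓘(ℝ, Coord d) 𝓘(ℝ, ℝ) ∞ F)
    {k : ∀ b : B, TangentSpace 𝓘(ℝ, Coord d) b} {O : Set B}
    (hk : ContMDiffOn 𝓘(ℝ, Coord d) 𝓘(ℝ, Coord d).tangent ∞
      (fun b => (⟨b, k b⟩ : TangentBundle 𝓘(ℝ, Coord d) B)) O) :
    ∃ C : Set B, IsClosed C ∧ resonantSet F k O = O ∩ C := by
  obtain ⟨C, hC, h⟩ := continuousOn_iff_isClosed.1 (continuousOn_diff_apply hF hk) {0}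
    isClosed_singleton
  refine ⟨C, hC, ?_⟩
  rw [inter_comm, ← h]
  ext b
  exact and_comm

/-- A section of `E` is parallel, as a combination with a single term and coefficient `1`, so
Rüssmann's condition applies to it directly. -/
theorem interior_resonantSet_eq_empty {F : B → ℝ} (hR : IsRussmann σ π F)
    {k : ∀ b : B, TangentSpace 𝓘(ℝ, Coord d) b} {O : Set B} (hO : IsOpen O)
    (hk : IsResonanceSection σ π k O) (hk0 : ∀ b ∈ O, k b ≠ 0) :
    interior (resonantSet F k O) = ∅ := by
  by_contra hne
  refine hR O k hO (fun b hb => ⟨O, hO, hb, Subset.rfl, 1, fun _ => k, fun _ => 1, fun _ => hk,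
    fun x _ => by simp⟩) hk0 ⟨interior (resonantSet F k O), isOpen_interior,
    nonempty_iff_ne_empty.2 hne, fun b hb => (interior_subset hb).1,
    fun b hb => (interior_subset hb).2⟩

variable [IsManifold 𝓘(ℝ, Coord (2 * d)) ∞ M] [T2Space M] [T2Space B]

theorem IsTorusChart.intCombination_mem (hπ : IsLagrangianTorusFibration σ π)
    (hχ : IsTorusChart σ π b p χ) {K : Fin d → ∀ b : B, TangentSpace 𝓘(ℝ, Coord d) b}
    (hK : ∀ i j, p i (K j b) = if i = j then 1 else 0) (n : Fin d → ℤ) :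
    intCombination K n b ∈ resonanceLattice σ π b :=
  (hχ.mem_resonanceLattice_iff hπ).2 ⟨n, apply_intCombination hK n⟩

theorem IsTorusChart.exists_eq_intCombination (hπ : IsLagrangianTorusFibration σ π)
    (hχ : IsTorusChart σ π b p χ) {K : Fin d → ∀ b : B, TangentSpace 𝓘(ℝ, Coord d) b}
    (hK : ∀ i j, p i (K j b) = if i = j then 1 else 0) {k : TangentSpace 𝓘(ℝ, Coord d) b}
    (hk : k ∈ resonanceLattice σ π b) : ∃ n : Fin d → ℤ, k = intCombination K n b := by
  obtain ⟨n, hn⟩ := (hχ.mem_resonanceLattice_iff hπ).1 hk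
  exact ⟨n, hχ.ext_of_apply_eq fun j => (hn j).trans (apply_intCombination hK n j).symm⟩

/-- Countably many frame domains cover the base. At a point of the resonant set of any section, its
value is an integer combination of a frame, so the point is resonant for the combination with those
fixed integers over the whole frame domain. Only the value at that point matters, so the integers
need not be shown locally constant. -/
theorem exists_countable_resonanceSections [SecondCountableTopology B]
    (hπ : IsLagrangianTorusFibration σ π) (F : B → ℝ) :
    ∃ S ⊆ resonanceSections σ π, S.Countable ∧
      ⋃ p ∈ resonanceSections σ π, resonantSet F p.2 p.1 = ⋃ p ∈ S, resonantSet F p.2 p.1 := by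
  choose O hO hbO K hK hframe using exists_localFrame hπ
  obtain ⟨s, hs, hcover⟩ := TopologicalSpace.countable_cover_nhds fun b => (hO b).mem_nhds (hbO b)
  let S : Set (Set B × (∀ b : B, TangentSpace 𝓘(ℝ, Coord d) b)) :=
    (fun q : B × (Fin d → ℤ) => (O q.1, intCombination (K q.1) q.2)) '' (s ×ˢ {n | n ≠ 0})
  have hS : S ⊆ resonanceSections σ π := by
    rintro _ ⟨⟨b, n⟩, ⟨-, hn⟩, rfl⟩
    refine ⟨hO b, ⟨contMDiffOn_intCombination (hK b) n, fun x hx => ?_⟩, fun x hx => ?_⟩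
    · obtain ⟨p, χ, hχ, hp⟩ := hframe b x hx
      exact hχ.intCombination_mem hπ hp n
    · obtain ⟨p, χ, hχ, hp⟩ := hframe b x hx
      exact intCombination_ne_zero hp hn
  refine ⟨S, hS, (hs.prod (to_countable _)).image _, Subset.antisymm ?_ ?_⟩
  · refine iUnion₂_subset fun q hq x hx => ?_
    obtain ⟨b, hb, hxb⟩ := mem_iUnion₂.1 (hcover ▸ mem_univ x)
    obtain ⟨p, χ, hχ, hp⟩ := hframe b x hxb
    obtain ⟨n, hn⟩ := hχ.exists_eq_intCombination hπ hp (hq.2.1.2 x hx.1)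
    have hn0 : n ≠ 0 := by
      rintro rfl
      refine hq.2.2 x hx.1 (hn.trans ?_)
      simp [intCombination]
    refine mem_iUnion₂.2 ⟨_, ⟨(b, n), ⟨hb, hn0⟩, rfl⟩, hxb, ?_⟩
    exact (congrArg (diff F x) hn).symm.trans hx.2
  · exact biUnion_subset_biUnion_left hS

theorem isMeagre_iUnion_resonantSet [SecondCountableTopology B]
    (hπ : IsLagrangianTorusFibration σ π) {F : B → ℝ}
    (hF : ContMDiff 𝓘(ℝ, Coord d) 𝓘(ℝ, ℝ) ∞ F) (hR : IsRussmann σ π F) :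
    IsMeagre (⋃ p ∈ resonanceSections σ π, resonantSet F p.2 p.1) := by
  obtain ⟨S, hS, hSc, hU⟩ := exists_countable_resonanceSections hπ F
  rw [hU]
  refine isMeagre_biUnion hSc fun q hq => IsNowhereDense.isMeagre ?_
  have hq' := hS hq
  obtain ⟨C, hC, hqC⟩ := exists_isClosed_resonantSet_eq hF hq'.2.1.1
  have hint := interior_resonantSet_eq_empty hR hq'.1 hq'.2.1 hq'.2.2
  rw [hqC] at hint ⊢
  exact isNowhereDense_inter_of_isOpen_of_isClosed hq'.1 hC hint

/-- The base is locally compact and Hausdorff, hence a Baire space, so the complement of a meagre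
set is dense. -/
theorem dense_compl_iUnion_resonantSet [SecondCountableTopology B]
    (hπ : IsLagrangianTorusFibration σ π) {F : B → ℝ}
    (hF : ContMDiff 𝓘(ℝ, Coord d) 𝓘(ℝ, ℝ) ∞ F) (hR : IsRussmann σ π F) :
    Dense (⋃ p ∈ resonanceSections σ π, resonantSet F p.2 p.1)ᶜ := by
  have : LocallyCompactSpace B := ChartedSpace.locallyCompactSpace (Coord d) B
  exact dense_of_mem_residual (isMeagre_iUnion_resonantSet hπ hF hR)

/-- An integer relation `n` between the frequencies says that `dF` kills the combination of the
frame with coefficients `n`, which would put `b` in a resonant set. -/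
theorem exists_nonresonant_chart (hπ : IsLagrangianTorusFibration σ π) {F : B → ℝ} {b : B}
    (hb : b ∉ ⋃ p ∈ resonanceSections σ π, resonantSet F p.2 p.1) :
    ∃ p χ, IsTorusChart σ π b p χ ∧ ∃ ν : Coord d, diff F b = ∑ j, ν j • p j ∧
      ∀ n : Fin d → ℤ, n ≠ 0 → ∑ j, n j * ν j ≠ 0 := by
  obtain ⟨O, hO, hbO, K, hK, hframe⟩ := exists_localFrame hπ b
  obtain ⟨p, χ, hχ, hp⟩ := hframe b hbO
  obtain ⟨ν, hν⟩ := hχ.exists_eq_sum (diff F b)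
  refine ⟨p, χ, hχ, ν, hν, fun n hn h0 => hb (mem_iUnion₂.2 ⟨(O, intCombination K n), ?_, hbO, ?_⟩)⟩
  · refine ⟨hO, ⟨contMDiffOn_intCombination hK n, fun x hx => ?_⟩, fun x hx => ?_⟩
    · obtain ⟨p, χ, hχ, hp⟩ := hframe x hx
      exact hχ.intCombination_mem hπ hp n
    · obtain ⟨p, χ, hχ, hp⟩ := hframe x hx
      exact intCombination_ne_zero hp hn
  · refine (DFunLike.congr_fun hν _).trans ?_
    simp only [sum_apply, FunLike.coe_smul, Pi.smul_apply, smul_eq_mul,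
      apply_intCombination hp]
    simpa only [mul_comm] using h0

end Resonances

/-! ### Haar measure of a fibre and ergodicity -/

section TorusMeasure

attribute [local instance] instMeasureSpaceUnitAddCircle instIsAddHaarMeasureUnitAddCircleVolume
  instIsProbabilityMeasureUnitAddCircleVolume

variable {d : ℕ} {M : Type*} [TopologicalSpace M] [ChartedSpace (Coord (2 * d)) M]
  {B : Type*} [TopologicalSpace B] [ChartedSpace (Coord d) B]
  {π : M → B} {σ : SymplecticForm (2 * d) M} {b : B}
  {p : Fin d → (TangentSpace 𝓘(ℝ, Coord d) b →L[ℝ] ℝ)} {χ : Coord d → M}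

/-- The point of the torus with given coordinates. -/
def toTorus (u : Coord d) : UnitAddTorus (Fin d) := fun i => (u i : UnitAddCircle)

/-- The coordinates in `(0, 1]` of a point of the torus. -/
noncomputable def torusLift (τ : UnitAddTorus (Fin d)) : Coord d :=
  WithLp.toLp 2 fun i => (AddCircle.equivIoc 1 0 (τ i) : ℝ)

theorem toTorus_torusLift (τ : UnitAddTorus (Fin d)) : toTorus (torusLift τ) = τ :=
  funext fun _ => AddCircle.coe_equivIoc

theorem measurable_torusLift : Measurable (torusLift (d := d)) := by
  refine (WithLp.measurable_toLp 2 (Fin d → ℝ)).comp (measurable_pi_lambda _ fun i => ?_)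
  exact measurable_subtype_coe.comp
    ((AddCircle.measurableEquivIoc (1 : ℝ) 0).measurable.comp (measurable_pi_apply i))

theorem toTorus_eq_iff {u u' : Coord d} :
    toTorus u = toTorus u' ↔ ∃ z : Fin d → ℤ, u' = u + latticePoint z := by
  have h : ∀ i, (u i : UnitAddCircle) = (u' i : UnitAddCircle) ↔ ∃ z : ℤ, u' i = u i + z := by
    intro i
    rw [eq_comm, ← sub_eq_zero, ← AddCircle.coe_sub, AddCircle.coe_eq_zero_iff]
    refine exists_congr fun z => ?_
    rw [zsmul_one, eq_comm, sub_eq_iff_eq_add, add_comm]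
  constructor
  · intro hu
    choose z hz using fun i => (h i).1 (congrFun hu i)
    exact ⟨z, PiLp.ext hz⟩
  · rintro ⟨z, rfl⟩
    exact funext fun i => (h i).2 ⟨z i, rfl⟩

theorem IsTorusChart.torusLift_toTorus (hχ : IsTorusChart σ π b p χ) (u : Coord d) :
    χ (torusLift (toTorus u)) = χ u :=
  (hχ.eq_iff _ _).2 (toTorus_eq_iff.1 (toTorus_torusLift _))

/-- `torusLift` jumps, but it is Borel; an injective Borel map from a standard Borel space is a
measurable embedding, so no continuity of the composite is needed. -/
theorem IsTorusChart.measurableEmbedding [T2Space M] [SecondCountableTopology M]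
    [MeasurableSpace M] [BorelSpace M] (hχ : IsTorusChart σ π b p χ) :
    MeasurableEmbedding (χ ∘ torusLift) := by
  refine (hχ.continuous.measurable.comp measurable_torusLift).measurableEmbedding fun τ τ' h => ?_
  have := toTorus_eq_iff.2 ((hχ.eq_iff _ _).1 h)
  rwa [toTorus_torusLift, toTorus_torusLift] at this

variable [IsManifold 𝓘(ℝ, Coord (2 * d)) ∞ M] [IsManifold 𝓘(ℝ, Coord d) ∞ B]

/-- Completeness comes for free: in a torus chart the integral curves are linear, hence defined for
all times. -/
theorem exists_isFlow_hamVF_comp_proj (hπ : IsLagrangianTorusFibration σ π) {f : B → ℝ}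
    (hf : ContMDiff 𝓘(ℝ, Coord d) 𝓘(ℝ, ℝ) ∞ f) :
    ∃ φ : ℝ → M → M, IsFlow (σ.hamVF (f ∘ π)) φ := by
  have h : ∀ m : M, ∃ γ : ℝ → M, γ 0 = m ∧
      IsMIntegralCurve (I := 𝓘(ℝ, Coord (2 * d))) γ (σ.hamVF (f ∘ π)) := by
    intro m
    obtain ⟨O, hO, hbO, K, hK, hframe⟩ := exists_localFrame hπ (π m)
    obtain ⟨p, χ, hχ, -⟩ := hframe _ hbO
    obtain ⟨ν, hν⟩ := hχ.exists_eq_sum (diff f (π m))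
    have hm : m ∈ range χ := by rw [hχ.range_eq]; rfl
    obtain ⟨u, rfl⟩ := hm
    exact ⟨_, by simp, hχ.integralCurve f (hf.mdifferentiable (by simp)) ν hν u⟩
  choose γ hγ using h
  exact ⟨fun t m => γ m t, hγ⟩

variable [T2Space M]

/-- By uniqueness of integral curves, any flow of `X_{f ∘ π}` is conjugate on the fibre to a
translation of the standard torus. Both the invariance of the Haar measure and ergodicity are read
off from this. -/
theorem IsTorusChart.flow_apply_torusLift (hπ : IsLagrangianTorusFibration σ π)
    (hχ : IsTorusChart σ π b p χ) {f : B → ℝ} (hf : ContMDiff 𝓘(ℝ, Coord d) 𝓘(ℝ, ℝ) ∞ f)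
    {ν : Coord d} (hν : diff f b = ∑ j, ν j • p j) {φ : ℝ → M → M}
    (hφ : IsFlow (σ.hamVF (f ∘ π)) φ) (t : ℝ) :
    φ t ∘ (χ ∘ torusLift) = (χ ∘ torusLift) ∘ fun τ => τ + toTorus (t • ν) := by
  funext τ
  refine (hχ.integralCurve_eq hπ hf hν (hφ (χ (torusLift τ))).2
    (hφ (χ (torusLift τ))).1.symm t).trans ?_
  refine (hχ.torusLift_toTorus _).symm.trans (congrArg (χ ∘ torusLift) ?_)
  change _ = τ + _
  conv_rhs => rw [← toTorus_torusLift τ]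
  rfl

variable [SecondCountableTopology M] [MeasurableSpace M] [BorelSpace M]

theorem IsTorusChart.isTorusHaar [T2Space B] (hπ : IsLagrangianTorusFibration σ π)
    (hχ : IsTorusChart σ π b p χ) :
    IsTorusHaar σ π b ((volume : Measure (UnitAddTorus (Fin d))).map (χ ∘ torusLift)) := by
  have hemb := hχ.measurableEmbedding
  refine ⟨Measure.isProbabilityMeasure_map hemb.measurable.aemeasurable, ?_, ?_⟩
  · rw [hemb.map_apply]
    have : χ ∘ torusLift ⁻¹' (π ⁻¹' {b})ᶜ = ∅ := by
      rw [← hχ.range_eq]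
      exact eq_empty_of_forall_notMem fun τ hτ => hτ (mem_range_self _)
    rw [this, measure_empty]
  · intro f hf φ hφ t A hA
    obtain ⟨ν, hν⟩ := hχ.exists_eq_sum (diff f b)
    rw [hemb.map_apply, hemb.map_apply, ← preimage_comp,
      hχ.flow_apply_torusLift hπ hf hν hφ, preimage_comp, measure_preimage_add_right]

theorem IsTorusChart.isErgodicTorus [T2Space B] (hπ : IsLagrangianTorusFibration σ π)
    (hχ : IsTorusChart σ π b p χ) {F : B → ℝ} (hF : ContMDiff 𝓘(ℝ, Coord d) 𝓘(ℝ, ℝ) ∞ F)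
    {ν : Coord d} (hν : diff F b = ∑ j, ν j • p j)
    (hn : ∀ n : Fin d → ℤ, n ≠ 0 → ∑ j, n j * ν j ≠ 0) : IsErgodicTorus σ π (F ∘ π) b := by
  have hemb := hχ.measurableEmbedding
  obtain ⟨φ, hφ⟩ := exists_isFlow_hamVF_comp_proj hπ hF
  refine ⟨_, hχ.isTorusHaar hπ, φ, hφ, fun A hA hinv => ?_⟩
  rw [hemb.map_apply, hemb.map_apply, preimage_compl]
  refine ergodic_linear_flow hn (hemb.measurable hA) fun t => ?_
  have h := hemb.measurable.quasiMeasurePreserving (volume : Measure (UnitAddTorus (Fin d)))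
    |>.preimage_ae_eq (hinv t)
  rwa [← preimage_comp, hχ.flow_apply_torusLift hπ hF hν hφ, preimage_comp] at h

end TorusMeasure

end TorusFibration

/-! ### The main theorem -/

theorem mainTheorem3 (d : ℕ)
    {M : Type*} [TopologicalSpace M] [T2Space M] [SecondCountableTopology M]
    [ChartedSpace (Coord (2 * d)) M] [IsManifold 𝓘(ℝ, Coord (2 * d)) ∞ M]
    [MeasurableSpace M] [BorelSpace M]
    {B : Type*} [TopologicalSpace B] [T2Space B] [SecondCountableTopology B]
    [ChartedSpace (Coord d) B] [IsManifold 𝓘(ℝ, Coord d) ∞ B]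
    (σ : SymplecticForm (2 * d) M) (π : M → B) (hπ : IsLagrangianTorusFibration σ π)
    (F : B → ℝ) (hF : ContMDiff 𝓘(ℝ, Coord d) 𝓘(ℝ, ℝ) ∞ F) (hR : IsRussmann σ π F) :
    Dense {b : B | IsErgodicTorus σ π (F ∘ π) b} ∧
    (∀ p ∈ resonanceSections σ π,
      (∃ C : Set B, IsClosed C ∧ resonantSet F p.2 p.1 = p.1 ∩ C) ∧
      interior (resonantSet F p.2 p.1) = ∅) ∧
    (∃ S ⊆ resonanceSections σ π, S.Countable ∧
      ⋃ p ∈ resonanceSections σ π, resonantSet F p.2 p.1 = ⋃ p ∈ S, resonantSet F p.2 p.1) ∧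
    interior (⋃ p ∈ resonanceSections σ π, resonantSet F p.2 p.1) = ∅ := by
  have hdense := dense_compl_iUnion_resonantSet hπ hF hR
  refine ⟨hdense.mono fun b hb => ?_, fun p hp => ⟨exists_isClosed_resonantSet_eq hF hp.2.1.1,
    interior_resonantSet_eq_empty hR hp.1 hp.2.1 hp.2.2⟩,
    exists_countable_resonanceSections hπ F, interior_eq_empty_iff_dense_compl.2 hdense⟩
  obtain ⟨p, χ, hχ, ν, hν, hn⟩ := exists_nonresonant_chart hπ hb
  exact hχ.isErgodicTorus hπ hF hν hn
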